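/- Let $\mathbf k$ be a field of characteristic zero. In this statement an *operad* is a pseudo-operad $P=(P(l))_{l\ge 1}$ in the category of $\mathbb Z$-graded (unbounded) chain complexes of $\mathbf k$-vector spaces with differential of degree $-1$: each $P(l)$ has a right action of the symmetric group $\Sigma_l$ by chain maps, and there are chain maps $\circ_i\colon P(l)\otimes P(m)\to P(l+m-1)$, $1\le i\le l$, satisfying the usual associativity and equivariance axioms (with the Koszul sign rule); no unit is required. Its homology $HP$ is an operad with zero differential. A morphism of operads $P\to Q$ is a *weak equivalence* if $H_i(P(l))\to H_i(Q(l))$ is an isomorphism for all $l,i$. An operad $P'$ is a *model* of $P$ if $P$ and $P'$ are connected by a finite chain of weak equivalences of operads, in either direction; such a chain induces an isomorphism $HP'\cong HP$, and hence a homomorphism $H\colon\mathrm{Aut}(P')\to\mathrm{Aut}(HP')\cong\mathrm{Aut}(HP)$. The operad $P$ is *formal* if $HP$ is a model of $P$. For $\alpha\in\mathbf k^*$ the *grading automorphism* $\phi_\alpha\in\mathrm{Aut}(HP)$ is multiplication by $\alpha^i$ in degree $i$. A *weight function* on $\mathbf k$ is a group homomorphism $w\colon\Gamma\to\mathbb Z$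 from a subgroup $\Gamma\subseteq\overline{\mathbf k}^*$, where $\overline{\mathbf k}$ is an algebraic closure of $\mathbf k$. An endomorphism $f$ of an operad $P'$ whose homology is finite dimensional in each arity and degree is called *pure* (of weight $0$, with respect to $w$) if for all $l$ and $i$ every root in $\overline{\mathbf k}$ of the characteristic polynomial of $H_i(f(l))$ lies in $\Gamma$ and has weight $i$. **Theorem.** Let $P$ be an operad over $\mathbf k$ with $H(P(1))=0$ and with homology of finite type, that is, $\bigoplus_{i}H_i(P(l))$ is a finite dimensional $\mathbf k$-vector space for every $l$. The following statements are equivalent: 1. $P$ is formal. 2. There exist a model $P'$ of $P$, and a chain of weak equivalences connecting them, such that $H\colon\mathrm{Aut}(P')\to\mathrm{Aut}(HP)$ is surjective. 3. There exist a model $P'$ of $P$, with a chain of weak equivalences connecting them, and $f\in\mathrm{Aut}(P')$ such that $H(f)=\phi_\alpha$ for some $\alpha\in\mathbf k^*$ that is not a root of unity. 4. There exist a model $P'$ of $P$, a weight function $w$ on $\mathbf k$, and an endomorphism $f$ of $P'$ that is pure with respect to $w$. -/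

import Mathlib

open CategoryTheory

universe u

namespace DGOp

/-! ### Insertion of inputs

Arities and inputs: an operation of arity `l` has inputs labelled by `Fin l` (counted from `0`).
Inserting an operation of arity `m` at the input `a` of an operation of arity `l` produces an
operation of arity `n`, where `l + m = n + 1`. -/

/-- The position, among the inputs of `f ∘ₐ g`, of the input `b` of `g`. -/
def innerSlot {l m n : ℕ} (h : l + m = n + 1) (a : Fin l) (b : Fin m) : Fin n :=
  ⟨a.1 + b.1, by have := a.2; have := b.2; omega⟩

/-- The position, among the inputs of `f ∘ₐ g`, of the input `b ≠ a` of `f`. -/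
def outerSlot {l m n : ℕ} (h : l + m = n + 1) (a b : Fin l) (hb : b ≠ a) : Fin n :=
  ⟨if b.1 < a.1 then b.1 else b.1 + m - 1, by
    have := a.2; have := b.2; have : b.1 ≠ a.1 := fun e => hb (Fin.ext e)
    split <;> omega⟩

/-- The inputs of `f ∘ₐ g` are the inputs of `f` other than `a`, together with those of `g`. -/
noncomputable def slotEquiv {l m n : ℕ} (h : l + m = n + 1) (a : Fin l) :
    {b : Fin l // b ≠ a} ⊕ Fin m ≃ Fin n :=
  Equiv.ofBijective
    (Sum.elim (fun b => outerSlot h a b.1 b.2) (fun b => innerSlot h a b)) (by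
      constructor
      · rintro (⟨b, hb⟩ | b) (⟨c, hc⟩ | c) e
        · have hb' : b.1 ≠ a.1 := fun e => hb (Fin.ext e)
          have hc' : c.1 ≠ a.1 := fun e => hc (Fin.ext e)
          have e' := congrArg Fin.val e
          simp only [Sum.elim_inl, outerSlot] at e'
          have : b = c := by
            apply Fin.ext
            split at e' <;> split at e' <;> omega
          subst this; rfl
        · have hb' : b.1 ≠ a.1 := fun e => hb (Fin.ext e)
          have e' := congrArg Fin.val e
          have := c.2
          simp only [Sum.elim_inl, Sum.elim_inr, outerSlot, innerSlot] at e'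
          exfalso
          split at e' <;> omega
        · have hc' : c.1 ≠ a.1 := fun e => hc (Fin.ext e)
          have e' := congrArg Fin.val e
          have := b.2
          simp only [Sum.elim_inl, Sum.elim_inr, outerSlot, innerSlot] at e'
          exfalso
          split at e' <;> omega
        · have e' := congrArg Fin.val e
          simp only [Sum.elim_inr, innerSlot] at e'
          have : b = c := Fin.ext (by omega)
          rw [this]
      · intro x
        have hx := x.2
        have ha := a.2
        by_cases h1 : x.1 < a.1
        · refine ⟨Sum.inl ⟨⟨x.1, by omega⟩, fun e => ?_⟩, Fin.ext ?_⟩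
          · have := congrArg Fin.val e; simp at this; omega
          · exact if_pos h1
        · by_cases h2 : x.1 < a.1 + m
          · exact ⟨Sum.inr ⟨x.1 - a.1, by omega⟩, Fin.ext (by simp [innerSlot]; omega)⟩
          · refine ⟨Sum.inl ⟨⟨x.1 + 1 - m, by omega⟩, fun e => ?_⟩, Fin.ext ?_⟩
            · have := congrArg Fin.val e; simp at this; omega
            · simp only [Sum.elim_inl, outerSlot]
              split <;> omega)

/-- The permutation `τ ∘ₐ σ` of the inputs: the inputs of `g` are permuted by `σ`, the other ones
by `τ`, and the block at `a` is moved to the place `τ a`. -/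
noncomputable def insertPerm {l m n : ℕ} (h : l + m = n + 1) (τ : Equiv.Perm (Fin l)) (a : Fin l)
    (σ : Equiv.Perm (Fin m)) : Equiv.Perm (Fin n) :=
  (slotEquiv h a).symm.trans
    ((Equiv.sumCongr (τ.subtypeEquiv fun b => (τ.injective.ne_iff (x := b) (y := a)).symm) σ).trans
      (slotEquiv h (τ a)))

end DGOp

/-! ### Dg operads -/

/-- A dg pseudo-operad over `k`: a family of `ℤ`-graded chain complexes of `k`-vector spaces
(differential of degree `-1`), one for each arity `n ≥ 1`, with right actions of the symmetric
groups and partial compositions `∘ₐ` that are chain maps `P(l) ⊗ P(m) ⟶ P(l + m - 1)`, subject to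
the associativity and equivariance axioms. `X n i` is the degree `i` part in arity `n`; there is
nothing in arity `0`. Indices which are sums are given with an equation. -/
structure DGOperad (k : Type u) [Field k] where
  X : ℕ → ℤ → Type u
  [addCommGroup : ∀ n i, AddCommGroup (X n i)]
  [module : ∀ n i, Module k (X n i)]
  arity_zero : ∀ i, Subsingleton (X 0 i)
  /-- The differential; only the components with `j + 1 = i` are relevant, the others vanish. -/
  d : ∀ n i j, X n i →ₗ[k] X n j
  d_shape : ∀ n i j, j + 1 ≠ i → d n i j = 0
  d_comp_d : ∀ n i j j' (x : X n i), d n j j' (d n i j x) = 0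
  /-- The right action of the symmetric group: `act n σ i x` is `x · σ`. -/
  act : ∀ n, Equiv.Perm (Fin n) → ∀ i, X n i →ₗ[k] X n i
  act_one : ∀ n i (x : X n i), act n 1 i x = x
  act_mul : ∀ n (σ τ : Equiv.Perm (Fin n)) i (x : X n i),
    act n (σ * τ) i x = act n τ i (act n σ i x)
  act_d : ∀ n (σ : Equiv.Perm (Fin n)) i j (x : X n i),
    d n i j (act n σ i x) = act n σ j (d n i j x)
  /-- `circ h a hd f g` is the partial composition `f ∘ₐ g`. -/
  circ : ∀ {l m n : ℕ} (_ : l + m = n + 1) (_ : Fin l) {p q r : ℤ} (_ : p + q = r),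
    X l p →ₗ[k] X m q →ₗ[k] X n r
  circ_d : ∀ {l m n : ℕ} (h : l + m = n + 1) (a : Fin l) {p q r p' q' r' : ℤ}
    (hd : p + q = r) (hp : p' + 1 = p) (hq : q' + 1 = q) (hr : r' + 1 = r)
    (f : X l p) (g : X m q),
    d n r r' (circ h a hd f g) =
      circ h a (by omega : p' + q = r') (d l p p' f) g +
        p.negOnePow • circ h a (by omega : p + q' = r') f (d m q q' g)
  circ_act : ∀ {l m n : ℕ} (h : l + m = n + 1) (a : Fin l) {p q r : ℤ} (hd : p + q = r)
    (τ : Equiv.Perm (Fin l)) (σ : Equiv.Perm (Fin m)) (f : X l p) (g : X m q),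
    circ h a hd (act l τ p f) (act m σ q g) =
      act n (DGOp.insertPerm h τ a σ) r (circ h (τ a) hd f g)
  /-- Sequential associativity: `f ∘ₐ (g ∘_b e) = (f ∘ₐ g) ∘_{a+b} e`. -/
  circ_assoc : ∀ {l m n s t v : ℕ} (hlm : l + m = s + 1) (hsn : s + n = t + 1)
    (hmn : m + n = v + 1) (hlv : l + v = t + 1) (a : Fin l) (b : Fin m)
    {p q r pq qr pqr : ℤ} (h₁ : p + q = pq) (h₂ : pq + r = pqr) (h₃ : q + r = qr)
    (h₄ : p + qr = pqr) (f : X l p) (g : X m q) (e : X n r),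
    circ hlv a h₄ f (circ hmn b h₃ g e) =
      circ hsn (DGOp.innerSlot hlm a b) h₂ (circ hlm a h₁ f g) e
  /-- Parallel associativity: for inputs `a ≠ b` of `f`, inserting `g` at `a` and then `e` at `b`
  agrees up to the Koszul sign with inserting `e` at `b` and then `g` at `a`. -/
  circ_comm : ∀ {l m n s t v : ℕ} (hlm : l + m = s + 1) (hsn : s + n = t + 1)
    (hln : l + n = v + 1) (hvm : v + m = t + 1) (a b : Fin l) (hab : a ≠ b)
    {p q r pq pr pqr : ℤ} (h₁ : p + q = pq) (h₂ : pq + r = pqr) (h₃ : p + r = pr)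
    (h₄ : pr + q = pqr) (f : X l p) (g : X m q) (e : X n r),
    circ hsn (DGOp.outerSlot hlm a b hab.symm) h₂ (circ hlm a h₁ f g) e =
      (q * r).negOnePow •
        circ hvm (DGOp.outerSlot hln b a hab) h₄ (circ hln b h₃ f e) g

namespace DGOperad

variable {k : Type u} [Field k]

attribute [instance] DGOperad.addCommGroup DGOperad.module

/-- A morphism of dg operads: chain maps, equivariant and compatible with compositions. -/
@[ext]
structure Hom (P Q : DGOperad k) where
  f : ∀ n i, P.X n i →ₗ[k] Q.X n i
  f_d : ∀ n i j (x : P.X n i), f n j (P.d n i j x) = Q.d n i j (f n i x)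
  f_act : ∀ n (σ : Equiv.Perm (Fin n)) i (x : P.X n i),
    f n i (P.act n σ i x) = Q.act n σ i (f n i x)
  f_circ : ∀ {l m n : ℕ} (h : l + m = n + 1) (a : Fin l) {p q r : ℤ} (hd : p + q = r)
    (x : P.X l p) (y : P.X m q),
    f n r (P.circ h a hd x y) = Q.circ h a hd (f l p x) (f m q y)

instance : Category (DGOperad k) where
  Hom P Q := Hom P Q
  id P :=
    { f := fun _ _ => LinearMap.id
      f_d := fun _ _ _ _ => rfl
      f_act := fun _ _ _ _ => rfl
      f_circ := fun _ _ _ _ _ _ _ _ => rfl }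
  comp F G :=
    { f := fun n i => (G.f n i).comp (F.f n i)
      f_d := fun n i j x => by simp [F.f_d, G.f_d]
      f_act := fun n σ i x => by simp [F.f_act, G.f_act]
      f_circ := fun h a {p q r} hd x y => by simp [F.f_circ, G.f_circ] }

@[ext]
lemma hom_ext {P Q : DGOperad k} {F G : P ⟶ Q} (h : ∀ n i x, F.f n i x = G.f n i x) : F = G :=
  Hom.ext (funext fun n => funext fun i => LinearMap.ext (h n i))

@[simp] lemma id_f (P : DGOperad k) (n i) (x : P.X n i) : Hom.f (𝟙 P) n i x = x := rfl

@[simp] lemma comp_f {P Q R : DGOperad k} (F : P ⟶ Q) (G : Q ⟶ R) (n i) (x : P.X n i) :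
    Hom.f (F ≫ G) n i x = G.f n i (F.f n i x) := rfl

/-! ### Homology -/

section Homology

variable (P : DGOperad k)

/-- The cycles of degree `i` in arity `n`. -/
def cycles (n : ℕ) (i : ℤ) : Submodule k (P.X n i) := LinearMap.ker (P.d n i (i - 1))

/-- The boundaries, as a subspace of the cycles. -/
def boundaries (n : ℕ) (i : ℤ) : Submodule k (P.cycles n i) :=
  (LinearMap.range (P.d n (i + 1) i)).comap (P.cycles n i).subtype

/-- The homology `H_i(P(n))`. -/
abbrev Homology (n : ℕ) (i : ℤ) : Type u := P.cycles n i ⧸ P.boundaries n i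

variable {P}

lemma mem_cycles {n : ℕ} {i : ℤ} {x : P.X n i} : x ∈ P.cycles n i ↔ P.d n i (i - 1) x = 0 :=
  Iff.rfl

lemma mem_boundaries {n : ℕ} {i : ℤ} {x : P.cycles n i} :
    x ∈ P.boundaries n i ↔ ∃ y, P.d n (i + 1) i y = x.1 := Iff.rfl

lemma d_of_mem_cycles {n : ℕ} {i j : ℤ} {x : P.X n i} (hx : x ∈ P.cycles n i) :
    P.d n i j x = 0 := by
  by_cases h : j + 1 = i
  · obtain rfl : j = i - 1 := by omega
    exact hx
  · rw [P.d_shape n i j h]; rfl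

/-- The class of a cycle. -/
def toHomology (n : ℕ) (i : ℤ) : P.cycles n i →ₗ[k] P.Homology n i := (P.boundaries n i).mkQ

lemma toHomology_surjective (n : ℕ) (i : ℤ) :
    Function.Surjective (toHomology (P := P) n i) := Submodule.mkQ_surjective _

lemma toHomology_eq_zero {n : ℕ} {i : ℤ} {x : P.cycles n i} :
    toHomology n i x = 0 ↔ ∃ y, P.d n (i + 1) i y = x.1 := by
  rw [toHomology, Submodule.mkQ_apply, Submodule.Quotient.mk_eq_zero, mem_boundaries]

/-- The map on homology induced by a degree zero map that commutes with the differentials. -/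
def homologyLift {Q : DGOperad k} {n : ℕ} (φ : ∀ i, P.X n i →ₗ[k] Q.X n i)
    (hφ : ∀ i j x, φ j (P.d n i j x) = Q.d n i j (φ i x)) (i : ℤ) :
    P.Homology n i →ₗ[k] Q.Homology n i :=
  Submodule.mapQ _ _
    (((φ i).comp (P.cycles n i).subtype).codRestrict (Q.cycles n i) (fun x => by
      rw [mem_cycles, LinearMap.comp_apply, ← hφ, Submodule.subtype_apply,
        d_of_mem_cycles x.2, map_zero]))
    (by
      rintro x ⟨y, hy⟩
      exact ⟨φ (i + 1) y, by rw [← hφ, hy]; rfl⟩)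

lemma homologyLift_toHomology {Q : DGOperad k} {n : ℕ} (φ : ∀ i, P.X n i →ₗ[k] Q.X n i)
    (hφ : ∀ i j x, φ j (P.d n i j x) = Q.d n i j (φ i x)) (i : ℤ) (x : P.cycles n i)
    (hx : φ i x.1 ∈ Q.cycles n i) :
    homologyLift φ hφ i (toHomology n i x) = toHomology n i ⟨φ i x.1, hx⟩ := rfl

lemma act_mem_cycles {n : ℕ} (σ : Equiv.Perm (Fin n)) {i : ℤ} {x : P.X n i}
    (hx : x ∈ P.cycles n i) : P.act n σ i x ∈ P.cycles n i := by
  rw [mem_cycles, P.act_d, d_of_mem_cycles hx, map_zero]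

lemma circ_mem_cycles {l m n : ℕ} (h : l + m = n + 1) (a : Fin l) {p q r : ℤ} (hd : p + q = r)
    {x : P.X l p} {y : P.X m q} (hx : x ∈ P.cycles l p) (hy : y ∈ P.cycles m q) :
    P.circ h a hd x y ∈ P.cycles n r := by
  rw [mem_cycles, P.circ_d h a hd (by omega : p - 1 + 1 = p) (by omega : q - 1 + 1 = q)
    (by omega), d_of_mem_cycles hx, d_of_mem_cycles hy]
  simp

/-- The composition of homology classes of cycles. -/
def circCycles {l m n : ℕ} (h : l + m = n + 1) (a : Fin l) {p q r : ℤ} (hd : p + q = r) :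
    P.cycles l p →ₗ[k] P.cycles m q →ₗ[k] P.Homology n r :=
  LinearMap.mk₂ k
    (fun x y => toHomology n r ⟨P.circ h a hd x.1 y.1, circ_mem_cycles h a hd x.2 y.2⟩)
    (fun x x' y => by rw [← map_add]; congr 1; ext; simp)
    (fun c x y => by rw [← map_smul]; congr 1; ext; simp)
    (fun x y y' => by rw [← map_add]; congr 1; ext; simp)
    (fun c x y => by rw [← map_smul]; congr 1; ext; simp)

lemma circCycles_left {l m n : ℕ} (h : l + m = n + 1) (a : Fin l) {p q r : ℤ} (hd : p + q = r) :
    P.boundaries l p ≤ LinearMap.ker (circCycles (P := P) (n := n) (m := m) (q := q) h a hd) := by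
  rintro x ⟨y, hy⟩
  rw [LinearMap.mem_ker]
  ext z
  refine toHomology_eq_zero.2 ⟨P.circ h a (by omega : p + 1 + q = r + 1) y z.1, ?_⟩
  rw [P.circ_d h a _ (by omega : p + 1 = p + 1) (by omega : q - 1 + 1 = q) (by omega), hy,
    d_of_mem_cycles z.2]
  simp

lemma circCycles_right {l m n : ℕ} (h : l + m = n + 1) (a : Fin l) {p q r : ℤ}
    (hd : p + q = r) (x : P.cycles l p) (y : P.cycles m q) (hy : y ∈ P.boundaries m q) :
    circCycles (P := P) (n := n) h a hd x y = 0 := by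
  obtain ⟨z, hz⟩ := hy
  refine toHomology_eq_zero.2
    ⟨p.negOnePow • P.circ h a (by omega : p + (q + 1) = r + 1) x.1 z, ?_⟩
  rw [Units.smul_def, map_zsmul,
    P.circ_d h a _ (by omega : p - 1 + 1 = p) (by omega : q + 1 = q + 1) (by omega), hz,
    d_of_mem_cycles x.2]
  simp [Units.smul_def, smul_smul, ← Units.val_mul]

/-- The composition on homology, `[x] ∘ₐ [y] = [x ∘ₐ y]`. -/
def circHomology {l m n : ℕ} (h : l + m = n + 1) (a : Fin l) {p q r : ℤ} (hd : p + q = r) :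
    P.Homology l p →ₗ[k] P.Homology m q →ₗ[k] P.Homology n r :=
  LinearMap.flip (Submodule.liftQ _
    (LinearMap.flip (Submodule.liftQ _ (circCycles h a hd) (circCycles_left h a hd)))
    (fun y hy => by
      rw [LinearMap.mem_ker]
      ext x
      exact circCycles_right h a hd x y hy))

lemma circHomology_toHomology {l m n : ℕ} (h : l + m = n + 1) (a : Fin l) {p q r : ℤ}
    (hd : p + q = r) (x : P.cycles l p) (y : P.cycles m q) :
    circHomology (P := P) (n := n) h a hd (toHomology l p x) (toHomology m q y) =
      toHomology n r ⟨P.circ h a hd x.1 y.1, circ_mem_cycles h a hd x.2 y.2⟩ := rfl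

lemma actHomology_toHomology {n : ℕ} (σ : Equiv.Perm (Fin n)) (i : ℤ) (x : P.cycles n i) :
    homologyLift (Q := P) (P.act n σ) (fun i j x => (P.act_d n σ i j x).symm) i
      (toHomology n i x) = toHomology n i ⟨P.act n σ i x.1, act_mem_cycles σ x.2⟩ := rfl

variable (P)

/-- The homology operad `HP`, with zero differential. -/
def homologyOperad : DGOperad k where
  X := P.Homology
  arity_zero i := by
    have := P.arity_zero i
    exact (toHomology_surjective (P := P) 0 i).subsingleton
  d _ _ _ := 0
  d_shape _ _ _ _ := rfl
  d_comp_d _ _ _ _ _ := rfl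
  act n σ := homologyLift (P.act n σ) (fun i j x => (P.act_d n σ i j x).symm)
  act_one n i x := by
    obtain ⟨x, rfl⟩ := toHomology_surjective n i x
    rw [actHomology_toHomology]
    congr 1; ext; exact P.act_one n i x.1
  act_mul n σ τ i x := by
    obtain ⟨x, rfl⟩ := toHomology_surjective n i x
    simp only [actHomology_toHomology]
    congr 1; ext; exact P.act_mul n σ τ i x.1
  act_d n σ i j x := by simp
  circ := circHomology
  circ_d h a {p q r p' q' r'} hd hp hq hr f g := by simp
  circ_act := by
    intro l m n h a p q r hd τ σ f g
    obtain ⟨f, rfl⟩ := toHomology_surjective _ _ f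
    obtain ⟨g, rfl⟩ := toHomology_surjective _ _ g
    simp only [actHomology_toHomology, circHomology_toHomology]
    congr 1; ext; exact P.circ_act h a hd τ σ f.1 g.1
  circ_assoc := by
    intro l m n s t v hlm hsn hmn hlv a b p q r pq qr pqr h₁ h₂ h₃ h₄ f g e
    obtain ⟨f, rfl⟩ := toHomology_surjective _ _ f
    obtain ⟨g, rfl⟩ := toHomology_surjective _ _ g
    obtain ⟨e, rfl⟩ := toHomology_surjective _ _ e
    simp only [circHomology_toHomology]
    congr 1; ext; exact P.circ_assoc hlm hsn hmn hlv a b h₁ h₂ h₃ h₄ f.1 g.1 e.1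
  circ_comm := by
    intro l m n s t v hlm hsn hln hvm a b hab p q r pq pr pqr h₁ h₂ h₃ h₄ f g e
    obtain ⟨f, rfl⟩ := toHomology_surjective _ _ f
    obtain ⟨g, rfl⟩ := toHomology_surjective _ _ g
    obtain ⟨e, rfl⟩ := toHomology_surjective _ _ e
    simp only [circHomology_toHomology]
    rw [Units.smul_def, ← map_zsmul]
    congr 1; ext; exact P.circ_comm hlm hsn hln hvm a b hab h₁ h₂ h₃ h₄ f.1 g.1 e.1

end Homology

lemma f_mem_cycles {P Q : DGOperad k} (F : P ⟶ Q) {n : ℕ} {i : ℤ} {x : P.X n i}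
    (hx : x ∈ P.cycles n i) : F.f n i x ∈ Q.cycles n i := by
  rw [mem_cycles, ← F.f_d, d_of_mem_cycles hx, map_zero]

/-- The map `H_i(P(n)) ⟶ H_i(Q(n))` induced by a morphism `P ⟶ Q`. -/
def homologyMap {P Q : DGOperad k} (F : P ⟶ Q) (n : ℕ) (i : ℤ) :
    P.Homology n i →ₗ[k] Q.Homology n i :=
  homologyLift (F.f n) (F.f_d n) i

lemma homologyMap_toHomology {P Q : DGOperad k} (F : P ⟶ Q) (n : ℕ) (i : ℤ)
    (x : P.cycles n i) :
    homologyMap F n i (toHomology n i x) = toHomology n i ⟨F.f n i x.1, f_mem_cycles F x.2⟩ :=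
  rfl

/-- The homology functor `H` on the category of dg operads. -/
def H : DGOperad k ⥤ DGOperad k where
  obj P := P.homologyOperad
  map {P Q} F :=
    { f := homologyMap F
      f_d := fun n i j x => map_zero _
      f_act := fun n σ i x => by
        obtain ⟨x, rfl⟩ := toHomology_surjective n i x
        refine congrArg (toHomology n i) (Subtype.ext ?_)
        exact F.f_act n σ i x.1
      f_circ := by
        intro l m n h a p q r hd x y
        obtain ⟨x, rfl⟩ := toHomology_surjective _ _ x
        obtain ⟨y, rfl⟩ := toHomology_surjective _ _ y
        refine congrArg (toHomology n r) (Subtype.ext ?_)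
        exact F.f_circ h a hd x.1 y.1 }
  map_id P := by
    ext n i x
    obtain ⟨x, rfl⟩ := toHomology_surjective n i x
    rfl
  map_comp F G := by
    ext n i x
    obtain ⟨x, rfl⟩ := toHomology_surjective n i x
    rfl

/-! ### Weak equivalences, models, formality -/

/-- A weak equivalence: a morphism inducing isomorphisms `H_i(P(n)) ≅ H_i(Q(n))` for all `n, i`. -/
def IsWeakEquiv {P Q : DGOperad k} (F : P ⟶ Q) : Prop :=
  ∀ n i, Function.Bijective (homologyMap F n i)

/-- The isomorphism of operads `HP ≅ HQ` induced by a weak equivalence. -/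
noncomputable def IsWeakEquiv.homologyIso {P Q : DGOperad k} {F : P ⟶ Q} (hF : IsWeakEquiv F) :
    H.obj P ≅ H.obj Q where
  hom := H.map F
  inv :=
    { f := fun n i => (LinearEquiv.ofBijective _ (hF n i)).symm.toLinearMap
      f_d := fun n i j x => map_zero _
      f_act := fun n σ i x => by
        obtain ⟨x, rfl⟩ := (hF n i).surjective x
        apply (hF n i).injective
        refine ((LinearEquiv.ofBijective _ (hF n i)).apply_symm_apply _).trans ?_
        refine ((H.map F).f_act n σ i x).symm.trans ?_
        refine congrArg (homologyMap F n i) (congrArg _ ?_)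
        exact ((LinearEquiv.ofBijective _ (hF n i)).symm_apply_apply x).symm
      f_circ := by
        intro l m n h a p q r hd x y
        obtain ⟨x, rfl⟩ := (hF _ _).surjective x
        obtain ⟨y, rfl⟩ := (hF _ _).surjective y
        apply (hF n r).injective
        refine ((LinearEquiv.ofBijective _ (hF n r)).apply_symm_apply _).trans ?_
        refine ((H.map F).f_circ h a hd x y).symm.trans ?_
        refine congrArg (homologyMap F n r) ?_
        refine congrArg₂ (fun x y => (H.obj P).circ h a hd x y) ?_ ?_
        · exact ((LinearEquiv.ofBijective _ (hF l p)).symm_apply_apply x).symm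
        · exact ((LinearEquiv.ofBijective _ (hF m q)).symm_apply_apply y).symm }
  hom_inv_id := by
    ext n i x
    exact (LinearEquiv.ofBijective _ (hF n i)).symm_apply_apply x
  inv_hom_id := by
    ext n i x
    exact (LinearEquiv.ofBijective _ (hF n i)).apply_symm_apply x

/-- A finite chain of weak equivalences, in either direction, from `P` to `Q`. -/
inductive Zigzag (P : DGOperad k) : DGOperad k → Type (u + 1)
  | refl : Zigzag P P
  | fwd {Q R : DGOperad k} (z : Zigzag P Q) (F : Q ⟶ R) (hF : IsWeakEquiv F) : Zigzag P R
  | bwd {Q R : DGOperad k} (z : Zigzag P Q) (F : R ⟶ Q) (hF : IsWeakEquiv F) : Zigzag P R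

/-- The isomorphism `HP ≅ HQ` induced by a chain of weak equivalences. -/
noncomputable def Zigzag.homologyIso {P : DGOperad k} :
    ∀ {Q : DGOperad k}, Zigzag P Q → (H.obj P ≅ H.obj Q)
  | _, .refl => Iso.refl _
  | _, .fwd z _ hF => z.homologyIso ≪≫ hF.homologyIso
  | _, .bwd z _ hF => z.homologyIso ≪≫ hF.homologyIso.symm

/-- Weakly equivalent dg operads; one then says that `Q` is a model of `P`. -/
def WeaklyEquivalent (P Q : DGOperad k) : Prop := Nonempty (Zigzag P Q)

/-- `P` is formal if it is weakly equivalent to its homology operad. -/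
def IsFormal (P : DGOperad k) : Prop := WeaklyEquivalent P (H.obj P)

/-- For a model `P'` of `P`, the homomorphism `Aut P' ⟶ Aut (HP)` given by homology and the
identification of `HP'` with `HP`. -/
noncomputable def Zigzag.autH {P P' : DGOperad k} (z : Zigzag P P') :
    Aut P' →* Aut (H.obj P) :=
  (Aut.autMulEquivOfIso z.homologyIso.symm).toMonoidHom.comp (H.mapAut P')

/-- `HP` is of finite type: the total space of `H(P(n))` is finite dimensional for each `n`. -/
def HomologyFiniteType (P : DGOperad k) : Prop :=
  ∀ n, Module.Finite k (DirectSum ℤ fun i => P.Homology n i)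

/-! ### Grading automorphisms -/

/-- For an operad with zero differential and `α ∈ kˣ`, multiplication by `α ^ i` in degree `i`. -/
def gradingHom (Q : DGOperad k) (hQ : ∀ n i j, Q.d n i j = 0) (α : kˣ) : Q ⟶ Q where
  f n i := ((α ^ i : kˣ) : k) • LinearMap.id
  f_d n i j x := by simp [hQ]
  f_act n σ i x := by simp
  f_circ := by
    intro l m n h a p q r hd x y
    subst hd
    simp [smul_smul, zpow_add₀, mul_comm]

/-- The grading automorphism `φ_α` of an operad with zero differential. -/
def gradingAut (Q : DGOperad k) (hQ : ∀ n i j, Q.d n i j = 0) (α : kˣ) : Aut Q where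
  hom := Q.gradingHom hQ α
  inv := Q.gradingHom hQ α⁻¹
  hom_inv_id := by
    ext n i x
    simp [gradingHom, smul_smul, α.ne_zero, zpow_ne_zero]
  inv_hom_id := by
    ext n i x
    simp [gradingHom, smul_smul, α.ne_zero, zpow_ne_zero]

/-- The grading automorphism `φ_α` of the homology operad `HP`. -/
def homologyGradingAut (P : DGOperad k) (α : kˣ) : Aut (H.obj P) :=
  gradingAut (H.obj P) (fun _ _ _ => rfl) α

end DGOperad

/-! ### Weights -/

/-- A weight function on a field `k`: a homomorphism to `ℤ` from a subgroup of the multiplicative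
group of an algebraic closure of `k`. -/
structure WeightFunction (k : Type u) [Field k] where
  Γ : Subgroup (AlgebraicClosure k)ˣ
  w : Γ →* Multiplicative ℤ

namespace WeightFunction

variable {k : Type u} [Field k]

/-- An element of the algebraic closure that is pure of weight `n`. -/
def IsPureElement (w : WeightFunction k) (n : ℤ) (x : AlgebraicClosure k) : Prop :=
  ∃ γ : w.Γ, ((γ : (AlgebraicClosure k)ˣ) : AlgebraicClosure k) = x ∧ (w.w γ).toAdd = n

/-- A polynomial that is pure of weight `n`: all its roots are. -/
def IsPurePolynomial (w : WeightFunction k) (n : ℤ) (q : Polynomial k) : Prop :=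
  ∀ x ∈ q.aroots (AlgebraicClosure k), w.IsPureElement n x

/-- An endomorphism of a finite dimensional vector space that is pure of weight `n`: its
characteristic polynomial is. -/
def IsPureLinear (w : WeightFunction k) (n : ℤ) {V : Type u} [AddCommGroup V] [Module k V]
    (f : V →ₗ[k] V) : Prop :=
  ∃ _ : Module.Finite k V, w.IsPurePolynomial n f.charpoly

/-- An endomorphism `f` of a dg operad that is pure of weight `n`: for each arity `l` and each
degree `i`, the endomorphism `H_i(f(l))` is pure of weight `n + i`. -/
def IsPureEndo (w : WeightFunction k) (n : ℤ) {P : DGOperad k} (f : P ⟶ P) : Prop :=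
  ∀ (l : ℕ) (i : ℤ), w.IsPureLinear (n + i) (DGOperad.homologyMap f l i)

end WeightFunction

/-! Three of the implications are short. An operad with zero differential is naturally isomorphic to
its homology, so if `P` is formal then every automorphism of `HP` lifts to the model `HP`.
Surjectivity lifts `φ_α` for `α = 2`. If `α` has infinite order, a lift of `φ_α` is pure for the
weight function that gives `α ^ i` the weight `i`. The substance is that an operad `P` with a pure
endomorphism `f` is formal (`isFormal_of_isPureEndo`).

If `P` had a weight grading with `H_i(P)` in weight `i`, formality would follow by truncation. No
such grading is at hand on chains and no minimal model is built; weights are introduced through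
coefficients instead. Let `A = ⨁ A_j`, where `A_j` consists of the sequences `ℤ → k` satisfying a
linear recurrence whose characteristic roots have weight `j`. Let `θ` be the backward shift and `g =
f ⊗ θ` on `P ⊗ A`, which is graded by the weights of `A`. A fixed vector in `H_i(P) ⊗ A` is a
sequence `h(n) = φ^n h(0)` with `φ = H_i(f)`. By Cayley–Hamilton every such sequence satisfies a
recurrence of weight `i`. Hence in weight `i` the fixed vectors correspond to their terms `h(0)`,
which are arbitrary. In weight `j ≠ i` the map `1 - g` is bijective, because polynomials of
different weights are coprime (`bijective_sub_map`).

Fixed points are then taken up to homotopy: forms `x(s) + y(s) ds` with `x` and `y` polynomial in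
`s` and `x(1) = g(x(0))`. In each weight, their homology in degree `i` is an extension of the kernel
of `1 - g` on `H_i` by its cokernel on `H_{i+1}`. In a weight `j ≤ i` the cokernel vanishes, as `j ≠
i + 1`, and the kernel is zero if `j < i` and `H_i(P)` if `j = i` (`isFormal_of_fixedPoints`).

Higher weights are discarded by a truncation: the elements of weight at most their degree whose part
of weight equal to the degree is a cycle form a suboperad. It maps to `P` by evaluation at `s = 0`
and at index `0`, and to `HP` by the class of the top weight part. Both maps are weak equivalences
(`WeightGrading.isFormal`). -/

open scoped TensorProduct

namespace DGOperad

variable {k : Type u} [Field k]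

/-! ### Extension of scalars along a commutative algebra -/

/-- The dg operad `P ⊗ A`, for a commutative algebra `A` in degree zero. -/
@[reducible] noncomputable def tensor (P : DGOperad k) (A : Type u) [CommRing A] [Algebra k A] :
    DGOperad k where
  X n i := P.X n i ⊗[k] A
  arity_zero i := by
    have := P.arity_zero i
    refine subsingleton_of_forall_eq 0 fun x => ?_
    induction x using TensorProduct.induction_on with
    | zero => rfl
    | tmul x a => rw [Subsingleton.elim x 0, TensorProduct.zero_tmul]
    | add x y hx hy => rw [hx, hy, add_zero]
  d n i j := (P.d n i j).rTensor A
  d_shape n i j h := by rw [P.d_shape n i j h, LinearMap.rTensor_zero]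
  d_comp_d n i j j' x := by
    rw [← LinearMap.comp_apply, ← LinearMap.rTensor_comp]
    have : P.d n j j' ∘ₗ P.d n i j = 0 := LinearMap.ext fun x => P.d_comp_d n i j j' x
    rw [this, LinearMap.rTensor_zero, LinearMap.zero_apply]
  act n σ i := (P.act n σ i).rTensor A
  act_one n i x := by
    have : P.act n 1 i = LinearMap.id := LinearMap.ext fun x => P.act_one n i x
    rw [this, LinearMap.rTensor_id, LinearMap.id_apply]
  act_mul n σ τ i x := by
    rw [← LinearMap.comp_apply, ← LinearMap.rTensor_comp]
    congr 2
    exact LinearMap.ext fun x => P.act_mul n σ τ i x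
  act_d n σ i j x := by
    rw [← LinearMap.comp_apply, ← LinearMap.comp_apply, ← LinearMap.rTensor_comp,
      ← LinearMap.rTensor_comp]
    congr 2
    exact LinearMap.ext fun x => P.act_d n σ i j x
  circ {_ _ _} h a {_ _ _} hd := TensorProduct.map₂ (P.circ h a hd) (LinearMap.mul k A)
  circ_d := by
    intro l m n h a p q r p' q' r' hd hp hq hr f g
    induction f using TensorProduct.induction_on with
    | zero => simp
    | add f f' hf hf' => simp only [map_add, LinearMap.add_apply, smul_add, hf, hf']; abel
    | tmul f s =>
      induction g using TensorProduct.induction_on with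
      | zero => simp
      | add g g' hg hg' => simp only [map_add, smul_add, hg, hg']; abel
      | tmul g t =>
        simp only [TensorProduct.map₂_apply_tmul, TensorProduct.map_tmul, LinearMap.rTensor_tmul,
          P.circ_d h a hd hp hq hr, TensorProduct.add_tmul, Units.smul_def,
          TensorProduct.smul_tmul']
  circ_act := by
    intro l m n h a p q r hd τ σ f g
    induction f using TensorProduct.induction_on with
    | zero => simp
    | add f f' hf hf' => simp only [map_add, LinearMap.add_apply, hf, hf']
    | tmul f s =>
      induction g using TensorProduct.induction_on with
      | zero => simp
      | add g g' hg hg' => simp only [map_add, hg, hg']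
      | tmul g t =>
        simp only [TensorProduct.map₂_apply_tmul, TensorProduct.map_tmul,
          LinearMap.rTensor_tmul, P.circ_act]
  circ_assoc := by
    intro l m n s t v hlm hsn hmn hlv a b p q r pq qr pqr h₁ h₂ h₃ h₄ f g e
    induction f using TensorProduct.induction_on with
    | zero => simp
    | add f f' hf hf' => simp only [map_add, LinearMap.add_apply, hf, hf']
    | tmul f x =>
      induction g using TensorProduct.induction_on with
      | zero => simp
      | add g g' hg hg' => simp only [map_add, LinearMap.add_apply, hg, hg']
      | tmul g y =>
        induction e using TensorProduct.induction_on with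
        | zero => simp
        | add e e' he he' => simp only [map_add, he, he']
        | tmul e z =>
          simp only [TensorProduct.map₂_apply_tmul, TensorProduct.map_tmul, LinearMap.mul_apply',
            P.circ_assoc hlm hsn hmn hlv a b h₁ h₂ h₃ h₄, mul_assoc]
  circ_comm := by
    intro l m n s t v hlm hsn hln hvm a b hab p q r pq pr pqr h₁ h₂ h₃ h₄ f g e
    induction f using TensorProduct.induction_on with
    | zero => simp
    | add f f' hf hf' => simp only [map_add, LinearMap.add_apply, smul_add, hf, hf']
    | tmul f x =>
      induction g using TensorProduct.induction_on with
      | zero => simp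
      | add g g' hg hg' => simp only [map_add, LinearMap.add_apply, smul_add, hg, hg']
      | tmul g y =>
        induction e using TensorProduct.induction_on with
        | zero => simp
        | add e e' he he' => simp only [map_add, LinearMap.add_apply, smul_add, he, he']
        | tmul e z =>
          simp only [TensorProduct.map₂_apply_tmul, TensorProduct.map_tmul, LinearMap.mul_apply',
            P.circ_comm hlm hsn hln hvm a b hab h₁ h₂ h₃ h₄, Units.smul_def,
            TensorProduct.smul_tmul']
          rw [mul_assoc, mul_comm y z, mul_assoc]

/-- The morphism `P ⊗ A ⟶ Q ⊗ B` given by `P ⟶ Q` and an algebra homomorphism `A → B`. -/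
noncomputable def tensorMap {P Q : DGOperad k} (F : P ⟶ Q) {A B : Type u} [CommRing A]
    [Algebra k A] [CommRing B] [Algebra k B] (χ : A →ₐ[k] B) : P.tensor A ⟶ Q.tensor B where
  f n i := TensorProduct.map (F.f n i) χ.toLinearMap
  f_d n i j x := by
    induction x using TensorProduct.induction_on with
    | zero => simp
    | add x y hx hy => simp only [map_add, hx, hy]
    | tmul x a => simp [F.f_d]
  f_act n σ i x := by
    induction x using TensorProduct.induction_on with
    | zero => simp
    | add x y hx hy => simp only [map_add, hx, hy]
    | tmul x a => simp [F.f_act]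
  f_circ := by
    intro l m n h a p q r hd x y
    induction x using TensorProduct.induction_on with
    | zero => simp
    | add x x' hx hx' => simp only [map_add, LinearMap.add_apply, hx, hx']
    | tmul x s =>
      induction y using TensorProduct.induction_on with
      | zero => simp
      | add y y' hy hy' => simp only [map_add, hy, hy']
      | tmul y t => simp [F.f_circ]

/-- The morphism `P ⊗ A ⟶ P` given by an augmentation of `A`. -/
noncomputable def tensorAug (P : DGOperad k) {A : Type u} [CommRing A] [Algebra k A]
    (χ : A →ₐ[k] k) : P.tensor A ⟶ P where
  f n i := TensorProduct.lift ((LinearMap.lsmul k (P.X n i)).flip.compr₂ LinearMap.id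
    |>.compl₂ χ.toLinearMap)
  f_d n i j x := by
    induction x using TensorProduct.induction_on with
    | zero => simp
    | add x y hx hy => simp only [map_add, hx, hy]
    | tmul x a => simp
  f_act n σ i x := by
    induction x using TensorProduct.induction_on with
    | zero => simp
    | add x y hx hy => simp only [map_add, hx, hy]
    | tmul x a => simp
  f_circ := by
    intro l m n h a p q r hd x y
    induction x using TensorProduct.induction_on with
    | zero => simp
    | add x x' hx hx' => simp only [map_add, LinearMap.add_apply, hx, hx']
    | tmul x s =>
      induction y using TensorProduct.induction_on with
      | zero => simp
      | add y y' hy hy' => simp only [map_add, hy, hy']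
      | tmul y t => simp [smul_smul, mul_comm]

lemma tensorAug_tmul (P : DGOperad k) {A : Type u} [CommRing A] [Algebra k A]
    (χ : A →ₐ[k] k) (n i) (x : P.X n i) (a : A) :
    (P.tensorAug χ).f n i (x ⊗ₜ a) = χ a • x := by
  simp [tensorAug]

/-! ### Suboperads -/

/-- A family of subspaces that is closed under all the operations. -/
structure Sub (Q : DGOperad k) where
  S : ∀ n i, Submodule k (Q.X n i)
  d_mem : ∀ n i j x, j + 1 = i → x ∈ S n i → Q.d n i j x ∈ S n j
  act_mem : ∀ n σ i x, x ∈ S n i → Q.act n σ i x ∈ S n i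
  circ_mem : ∀ {l m n : ℕ} (h : l + m = n + 1) (a : Fin l) {p q r : ℤ} (hd : p + q = r) x y,
    x ∈ S l p → y ∈ S m q → Q.circ h a hd x y ∈ S n r

lemma Sub.d_mem' {Q : DGOperad k} (S : Sub Q) (n i j x) (hx : x ∈ S.S n i) :
    Q.d n i j x ∈ S.S n j := by
  by_cases h : j + 1 = i
  · exact S.d_mem n i j x h hx
  · rw [Q.d_shape n i j h]; exact zero_mem _

/-- The suboperad given by a family of subspaces closed under the operations. -/
def Sub.operad {Q : DGOperad k} (S : Sub Q) : DGOperad k where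
  X n i := S.S n i
  arity_zero i := by
    have := Q.arity_zero i
    infer_instance
  d n i j := (Q.d n i j).restrict (fun x hx => S.d_mem' n i j x hx)
  d_shape n i j h := by
    ext x
    simp [Q.d_shape n i j h]
  d_comp_d n i j j' x := Subtype.ext (Q.d_comp_d n i j j' x)
  act n σ i := (Q.act n σ i).restrict (fun x hx => S.act_mem n σ i x hx)
  act_one n i x := Subtype.ext (Q.act_one n i x)
  act_mul n σ τ i x := Subtype.ext (Q.act_mul n σ τ i x)
  act_d n σ i j x := Subtype.ext (Q.act_d n σ i j x)
  circ {l m n} h a {p q r} hd := LinearMap.mk₂ k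
    (fun x y => ⟨Q.circ h a hd x.1 y.1, S.circ_mem h a hd x.1 y.1 x.2 y.2⟩)
    (fun x x' y => Subtype.ext (by simp))
    (fun c x y => Subtype.ext (by simp))
    (fun x y y' => Subtype.ext (by simp))
    (fun c x y => Subtype.ext (by simp))
  circ_d := by
    intro l m n h a p q r p' q' r' hd hp hq hr f g
    refine Subtype.ext ?_
    have := Q.circ_d h a hd hp hq hr f.1 g.1
    simpa [Units.smul_def] using this
  circ_act := by
    intro l m n h a p q r hd τ σ f g
    exact Subtype.ext (Q.circ_act h a hd τ σ f.1 g.1)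
  circ_assoc := by
    intro l m n s t v hlm hsn hmn hlv a b p q r pq qr pqr h₁ h₂ h₃ h₄ f g e
    exact Subtype.ext (Q.circ_assoc hlm hsn hmn hlv a b h₁ h₂ h₃ h₄ f.1 g.1 e.1)
  circ_comm := by
    intro l m n s t v hlm hsn hln hvm a b hab p q r pq pr pqr h₁ h₂ h₃ h₄ f g e
    refine Subtype.ext ?_
    have := Q.circ_comm hlm hsn hln hvm a b hab h₁ h₂ h₃ h₄ f.1 g.1 e.1
    simpa [Units.smul_def] using this

/-- The inclusion of a suboperad. -/
def Sub.incl {Q : DGOperad k} (S : Sub Q) : S.operad ⟶ Q where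
  f n i := (S.S n i).subtype
  f_d _ _ _ _ := rfl
  f_act _ _ _ _ := rfl
  f_circ _ _ _ _ _ _ _ _ := rfl

/-! ### Derivations and dual numbers -/

/-- A degree zero derivation of a dg operad, commuting with the differential. -/
structure Deriv (G : DGOperad k) where
  D : ∀ n i, G.X n i →ₗ[k] G.X n i
  D_d : ∀ n i j x, D n j (G.d n i j x) = G.d n i j (D n i x)
  D_act : ∀ n σ i x, D n i (G.act n σ i x) = G.act n σ i (D n i x)
  D_circ : ∀ {l m n : ℕ} (h : l + m = n + 1) (a : Fin l) {p q r : ℤ} (hd : p + q = r) x y,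
    D n r (G.circ h a hd x y) = G.circ h a hd (D l p x) y + G.circ h a hd x (D m q y)

/-- The identity `G(n)_i ⟶ G(n)_{j + 1}` when `i = j + 1`. -/
def castSucc (G : DGOperad k) (n : ℕ) (i j : ℤ) : G.X n i →ₗ[k] G.X n (j + 1) :=
  if h : j + 1 = i then h ▸ LinearMap.id else 0

lemma castSucc_self (G : DGOperad k) (n : ℕ) (j : ℤ) :
    G.castSucc n (j + 1) j = LinearMap.id := dif_pos rfl

lemma castSucc_ne (G : DGOperad k) (n : ℕ) (i j : ℤ) (h : j + 1 ≠ i) :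
    G.castSucc n i j = 0 := dif_neg h

set_option maxHeartbeats 2000000 in
/-- The dg operad `G ⊕ G ds` with `ds` of degree `-1`, and differential twisted by
`x ↦ ± D x ds`. -/
@[reducible] def Deriv.forms {G : DGOperad k} (D : Deriv G) : DGOperad k where
  X n i := G.X n i × G.X n (i + 1)
  arity_zero i := by
    have := G.arity_zero i
    have := G.arity_zero (i + 1)
    infer_instance
  d n i j := LinearMap.prod (G.d n i j ∘ₗ LinearMap.fst k _ _)
    (G.d n (i + 1) (j + 1) ∘ₗ LinearMap.snd k _ _ +
      ((i.negOnePow : ℤˣ) : ℤ) • (G.castSucc n i j ∘ₗ D.D n i) ∘ₗ LinearMap.fst k _ _)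
  d_shape n i j h := by
    rw [G.d_shape n i j h, G.castSucc_ne n i j h,
      G.d_shape n (i + 1) (j + 1) (fun e => h (by omega))]
    ext <;> simp
  d_comp_d n i j j' x := by
    by_cases h : j + 1 = i
    · by_cases h' : j' + 1 = j
      · subst h; subst h'
        ext
        · simp [G.d_comp_d]
        -- The cross terms `d (D x)` and `D (d x)` agree and carry the signs of two consecutive
        -- degrees, so they cancel.
        · rcases Int.units_eq_one_or (j' + 1).negOnePow with e | e <;>
            simp [castSucc_self, G.d_comp_d, D.D_d, Int.negOnePow_succ, e]
      · ext
        · simp [G.d_comp_d]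
        · simp [G.d_comp_d, castSucc_ne _ _ _ _ h', G.d_shape n (j + 1) (j' + 1)
            (fun e => h' (by omega))]
    · ext
      · simp [G.d_comp_d]
      · simp [G.d_comp_d, castSucc_ne _ _ _ _ h, G.d_shape n i j h]
  act n σ i := LinearMap.prodMap (G.act n σ i) (G.act n σ (i + 1))
  act_one n i x := by ext <;> simp [G.act_one]
  act_mul n σ τ i x := by ext <;> simp [G.act_mul]
  act_d n σ i j x := by
    ext
    · simp [G.act_d]
    · by_cases h : j + 1 = i
      · subst h
        simp [G.act_d, castSucc_self, D.D_act]
      · simp [G.act_d, castSucc_ne _ _ _ _ h]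
  circ {l m n} h a {p q r} hd := LinearMap.mk₂ k
    -- The sign comes from moving `ds`, of degree `-1`, past `y.1`, of degree `q`.
    (fun x y => (G.circ h a hd x.1 y.1,
      G.circ h a (by omega : p + (q + 1) = r + 1) x.1 y.2 +
        ((q.negOnePow : ℤˣ) : ℤ) • G.circ h a (by omega : p + 1 + q = r + 1) x.2 y.1))
    (fun x x' y => by ext <;> simp; abel)
    (fun c x y => by ext <;> simp [smul_comm c])
    (fun x y y' => by ext <;> simp; abel)
    (fun c x y => by ext <;> simp [smul_comm c])
  circ_d := by
    intro l m n h a p q r p' q' r' hd hp hq hr f g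
    subst hp; subst hq; subst hr
    obtain rfl : r' = p' + q' + 1 := by omega
    ext
    · simp [G.circ_d h a hd rfl rfl rfl]
    · have h₁ := G.circ_d h a (by omega : p' + 1 + (q' + 1 + 1) = p' + q' + 1 + 1 + 1)
        rfl rfl rfl f.1 g.2
      have h₂ := G.circ_d h a (by omega : p' + 1 + 1 + (q' + 1) = p' + q' + 1 + 1 + 1)
        rfl rfl rfl f.2 g.1
      have h₃ := D.D_circ h a hd f.1 g.1
      -- All signs depend only on the parities of `p'` and `q'`.
      rcases Int.units_eq_one_or p'.negOnePow with e | e <;>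
      rcases Int.units_eq_one_or q'.negOnePow with e' | e' <;>
      simp [castSucc_self, Int.negOnePow_add, e, e', Units.smul_def]
        at h₁ h₂ ⊢ <;> rw [h₁, h₂, h₃] <;> abel
  circ_act := by
    intro l m n h a p q r hd τ σ f g
    ext <;> simp [G.circ_act]
  circ_assoc := by
    intro l m n s t v hlm hsn hmn hlv a b p q r pq qr pqr h₁ h₂ h₃ h₄ f g e
    ext
    · exact G.circ_assoc hlm hsn hmn hlv a b h₁ h₂ h₃ h₄ _ _ _
    · simp only [LinearMap.mk₂_apply, map_add, map_zsmul, LinearMap.add_apply,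
        LinearMap.smul_apply]
      rw [G.circ_assoc hlm hsn hmn hlv a b h₁ (by omega : pq + (r + 1) = pqr + 1)
          (by omega : q + (r + 1) = qr + 1) (by omega),
        G.circ_assoc hlm hsn hmn hlv a b (by omega : p + (q + 1) = pq + 1)
          (by omega : pq + 1 + r = pqr + 1) (by omega : q + 1 + r = qr + 1) (by omega),
        G.circ_assoc hlm hsn hmn hlv a b (by omega : p + 1 + q = pq + 1)
          (by omega : pq + 1 + r = pqr + 1) h₃ (by omega)]
      subst h₃
      simp only [Int.negOnePow_add, smul_add, smul_smul, Units.val_mul]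
      rw [mul_comm (r.negOnePow : ℤ), add_assoc]
  circ_comm := by
    intro l m n s t v hlm hsn hln hvm a b hab p q r pq pr pqr h₁ h₂ h₃ h₄ f g e
    ext
    · simpa using G.circ_comm hlm hsn hln hvm a b hab h₁ h₂ h₃ h₄ f.1 g.1 e.1
    · simp only [LinearMap.mk₂_apply, map_add, map_zsmul, LinearMap.add_apply,
        LinearMap.smul_apply, Prod.smul_snd]
      rw [G.circ_comm hlm hsn hln hvm a b hab h₁ (by omega : pq + (r + 1) = pqr + 1)
          (by omega : p + (r + 1) = pr + 1) (by omega),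
        G.circ_comm hlm hsn hln hvm a b hab (by omega : p + (q + 1) = pq + 1)
          (by omega : pq + 1 + r = pqr + 1) h₃ (by omega),
        G.circ_comm hlm hsn hln hvm a b hab (by omega : p + 1 + q = pq + 1)
          (by omega : pq + 1 + r = pqr + 1) (by omega : p + 1 + r = pr + 1) (by omega)]
      rw [show q * (r + 1) = q * r + q by ring, show (q + 1) * r = q * r + r by ring]
      rcases Int.units_eq_one_or (q * r).negOnePow with e | e <;>
      rcases Int.units_eq_one_or q.negOnePow with e' | e' <;>
      rcases Int.units_eq_one_or r.negOnePow with e'' | e'' <;>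
      simp [Int.negOnePow_add, e, e', e''] <;> abel

end DGOperad

namespace DGOperad

variable {k : Type u} [Field k]

lemma mem_cycles_of_d {P : DGOperad k} {n : ℕ} {i j : ℤ} (h : j + 1 = i) {x : P.X n i}
    (hx : P.d n i j x = 0) : x ∈ P.cycles n i := by
  obtain rfl : j = i - 1 := by omega
  exact hx

lemma d_mem_cycles {P : DGOperad k} {n : ℕ} {i j : ℤ} (x : P.X n i) :
    P.d n i j x ∈ P.cycles n j := P.d_comp_d n i j (j - 1) x

lemma toHomology_eq_iff {P : DGOperad k} {n : ℕ} {i : ℤ} {x y : P.cycles n i} :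
    toHomology n i x = toHomology n i y ↔ ∃ w, P.d n (i + 1) i w = x.1 - y.1 := by
  rw [← sub_eq_zero, ← map_sub, toHomology_eq_zero]
  rfl

/-! ### Weight gradings and truncation -/

/-- A grading of a dg operad by weights, given by the projections to the homogeneous parts. -/
structure WeightGrading (Q : DGOperad k) where
  proj : ℤ → ∀ n i, Q.X n i →ₗ[k] Q.X n i
  proj_self : ∀ j n i x, proj j n i (proj j n i x) = proj j n i x
  proj_ne : ∀ j j' n i x, j ≠ j' → proj j n i (proj j' n i x) = 0
  proj_d : ∀ w n i j x, proj w n j (Q.d n i j x) = Q.d n i j (proj w n i x)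
  proj_act : ∀ w n σ i x, proj w n i (Q.act n σ i x) = Q.act n σ i (proj w n i x)
  proj_circ : ∀ {l m n : ℕ} (h : l + m = n + 1) (a : Fin l) {p q r : ℤ} (hd : p + q = r)
    (v w : ℤ) x y, proj (v + w) n r (Q.circ h a hd (proj v l p x) (proj w m q y)) =
      Q.circ h a hd (proj v l p x) (proj w m q y)
  -- Every larger finite set serves as well, so that several elements can be expanded over a common
  -- set.
  exists_sum : ∀ n i x, ∃ s : Finset ℤ, ∀ t, s ⊆ t → x = ∑ j ∈ t, proj j n i x

namespace WeightGrading

variable {Q : DGOperad k} (W : WeightGrading Q)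

/-- Weights add under composition, so only the pairs of weights `j` and `w - j` contribute. A finite
set that supports `x` suffices. -/
lemma proj_circ_sum {l m n : ℕ} (h : l + m = n + 1) (a : Fin l) {p q r : ℤ} (hd : p + q = r)
    (w : ℤ) (x : Q.X l p) (y : Q.X m q) : ∃ s : Finset ℤ, ∀ t, s ⊆ t →
      W.proj w n r (Q.circ h a hd x y) =
        ∑ j ∈ t, Q.circ h a hd (W.proj j l p x) (W.proj (w - j) m q y) := by
  obtain ⟨s, hs⟩ := W.exists_sum l p x
  obtain ⟨s', hs'⟩ := W.exists_sum m q y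
  refine ⟨s, fun t ht => ?_⟩
  conv_lhs => rw [hs t ht]
  simp only [map_sum, LinearMap.sum_apply]
  refine Finset.sum_congr rfl fun j _ => ?_
  -- Inserting `w - j` guarantees that the one surviving index occurs in the sum.
  conv_lhs => rw [hs' (insert (w - j) s') (Finset.subset_insert _ _)]
  simp only [map_sum]
  rw [Finset.sum_eq_single (w - j)]
  · have := W.proj_circ h a hd j (w - j) x y
    rwa [add_sub_cancel] at this
  · intro b _ hb
    rw [← W.proj_circ h a hd j b x y]
    exact W.proj_ne _ _ _ _ _ (by omega)
  · intro hb
    exact absurd (Finset.mem_insert_self _ _) hb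

/-- For operations `x` and `y` of weights at most `v` and `w`, the part of top weight of `x ∘ₐ y`
is the composition of those of `x` and `y`. -/
lemma proj_circ_top {l m n : ℕ} (h : l + m = n + 1) (a : Fin l) {p q r : ℤ} (hd : p + q = r)
    {v w : ℤ} {x : Q.X l p} {y : Q.X m q} (hx : ∀ j, v < j → W.proj j l p x = 0)
    (hy : ∀ j, w < j → W.proj j m q y = 0) :
    W.proj (v + w) n r (Q.circ h a hd x y) =
      Q.circ h a hd (W.proj v l p x) (W.proj w m q y) := by
  obtain ⟨s, hs⟩ := W.proj_circ_sum h a hd (v + w) x y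
  rw [hs (insert v s) (Finset.subset_insert _ _), Finset.sum_eq_single v]
  · rw [add_sub_cancel_left]
  · intro j _ hj
    rcases lt_or_gt_of_ne hj with hj | hj
    · rw [hy _ (by omega), map_zero]
    · rw [hx _ hj, map_zero, LinearMap.zero_apply]
  · intro hb
    exact absurd (Finset.mem_insert_self _ _) hb

lemma proj_circ_eq_zero {l m n : ℕ} (h : l + m = n + 1) (a : Fin l) {p q r : ℤ}
    (hd : p + q = r) {v w : ℤ} {x : Q.X l p} {y : Q.X m q}
    (hx : ∀ j, v < j → W.proj j l p x = 0) (hy : ∀ j, w < j → W.proj j m q y = 0) {u : ℤ}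
    (hu : v + w < u) : W.proj u n r (Q.circ h a hd x y) = 0 := by
  obtain ⟨s, hs⟩ := W.proj_circ_sum h a hd u x y
  rw [hs s le_rfl]
  refine Finset.sum_eq_zero fun j _ => ?_
  by_cases hj : v < j
  · rw [hx _ hj, map_zero, LinearMap.zero_apply]
  · rw [hy _ (by omega), map_zero]

/-- The suboperad of the `x` that have weight at most their degree `i`, the part of weight `i`
being a cycle. -/
def truncation : Sub Q where
  S n i := (⨅ j : {j : ℤ // i < j}, LinearMap.ker (W.proj j n i)) ⊓
    (Q.cycles n i).comap (W.proj i n i)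
  d_mem n i j x h hx := by
    subst h
    simp only [Submodule.mem_inf, Submodule.mem_iInf, LinearMap.mem_ker, Subtype.forall,
      Submodule.mem_comap, W.proj_d] at hx ⊢
    refine ⟨fun w hw => ?_, d_mem_cycles _⟩
    -- The differential lowers the bound on the weight from `j + 1` to `j`; the part of weight `j +
    -- 1` is killed because it was required to be a cycle.
    by_cases hw' : w = j + 1
    · subst hw'
      exact d_of_mem_cycles hx.2
    · rw [hx.1 w (by omega), map_zero]
  act_mem n σ i x hx := by
    simp only [Submodule.mem_inf, Submodule.mem_iInf, LinearMap.mem_ker, Subtype.forall,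
      Submodule.mem_comap, W.proj_act] at hx ⊢
    exact ⟨fun w hw => by rw [hx.1 w hw, map_zero], act_mem_cycles σ hx.2⟩
  circ_mem := by
    intro l m n h a p q r hd x y hx hy
    simp only [Submodule.mem_inf, Submodule.mem_iInf, LinearMap.mem_ker, Subtype.forall,
      Submodule.mem_comap] at hx hy ⊢
    subst hd
    refine ⟨fun w hw => W.proj_circ_eq_zero h a rfl hx.1 hy.1 hw, ?_⟩
    rw [W.proj_circ_top h a rfl hx.1 hy.1]
    exact circ_mem_cycles h a rfl hx.2 hy.2

lemma mem_truncation {n : ℕ} {i : ℤ} {x : Q.X n i} : x ∈ W.truncation.S n i ↔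
    (∀ j, i < j → W.proj j n i x = 0) ∧ W.proj i n i x ∈ Q.cycles n i := by
  simp [truncation]

/-- A homogeneous operation of weight less than its degree lies in the truncation. -/
lemma mem_truncation_of_lt {n : ℕ} {i w : ℤ} {x : Q.X n i} (hx : W.proj w n i x = x)
    (hw : w < i) : x ∈ W.truncation.S n i := by
  refine W.mem_truncation.2 ⟨fun j hj => ?_, ?_⟩
  · rw [← hx, W.proj_ne _ _ _ _ _ (by omega)]
  · rw [← hx, W.proj_ne _ _ _ _ _ (by omega)]
    exact zero_mem _

/-- A homogeneous cycle of weight equal to its degree lies in the truncation. -/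
lemma mem_truncation_of_mem_cycles {n : ℕ} {i : ℤ} {x : Q.X n i} (hx : W.proj i n i x = x)
    (hc : x ∈ Q.cycles n i) : x ∈ W.truncation.S n i := by
  refine W.mem_truncation.2 ⟨fun j hj => ?_, by rwa [hx]⟩
  rw [← hx, W.proj_ne _ _ _ _ _ (by omega)]

variable {P : DGOperad k} (ε : Q ⟶ P)

/-- The part of top weight of an operation in the truncation, as a cycle of `P`. -/
def topCycle (n : ℕ) (i : ℤ) : W.truncation.operad.X n i →ₗ[k] P.cycles n i :=
  ((ε.f n i ∘ₗ W.proj i n i) ∘ₗ (W.truncation.S n i).subtype).codRestrict _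
    fun x => f_mem_cycles ε (W.mem_truncation.1 x.2).2

/-- The morphism from the truncation to the homology of `P` that takes the class of the part of
top weight. -/
def toHomologyOperad : W.truncation.operad ⟶ H.obj P where
  f n i := toHomology n i ∘ₗ W.topCycle ε n i
  f_d n i j x := by
    by_cases h : j + 1 = i
    · subst h
      refine toHomology_eq_zero.2 ⟨ε.f n (j + 1) (W.proj j n (j + 1) x.1), ?_⟩
      rw [← ε.f_d, ← W.proj_d]
      rfl
    · rw [W.truncation.operad.d_shape n i j h]
      exact map_zero _
  f_act n σ i x := by
    refine congrArg (toHomology n i) (Subtype.ext ?_)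
    exact (congrArg (ε.f n i) (W.proj_act i n σ i x.1)).trans (ε.f_act n σ i _)
  f_circ := by
    intro l m n h a p q r hd x y
    refine congrArg (toHomology n r) (Subtype.ext ?_)
    subst hd
    exact (congrArg (ε.f n _) (W.proj_circ_top h a rfl (W.mem_truncation.1 x.2).1
      (W.mem_truncation.1 y.2).1)).trans (ε.f_circ h a rfl _ _)

/-- If the homology of a weight graded dg operad `Q` is concentrated, in weights up to the degree,
in the weight equal to the degree, where `ε : Q ⟶ P` induces isomorphisms, then `P` is formal. -/
theorem isFormal
    (h_lt : ∀ n i j (x : Q.X n i), j < i → x ∈ Q.cycles n i → W.proj j n i x = x →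
      ∃ y, Q.d n (i + 1) i y = x)
    (h_inj : ∀ n i (x : Q.X n i), x ∈ Q.cycles n i → W.proj i n i x = x →
      (∃ y, P.d n (i + 1) i y = ε.f n i x) → ∃ y, Q.d n (i + 1) i y = x)
    (h_surj : ∀ n i z, z ∈ P.cycles n i → ∃ x ∈ Q.cycles n i, W.proj i n i x = x ∧
      ∃ y, P.d n (i + 1) i y = ε.f n i x - z) : P.IsFormal := by
  -- A cycle of the truncation bounds there as soon as its top weight part bounds in `P`: each
  -- weight part bounds in `Q`, by `h_inj` in weight `i` and by `h_lt` below.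
  have key : ∀ n i (x : W.truncation.operad.X n i), x ∈ W.truncation.operad.cycles n i →
      (∃ y, P.d n (i + 1) i y = ε.f n i (W.proj i n i x.1)) →
      ∃ y, W.truncation.operad.d n (i + 1) i y = x := by
    intro n i x hx hy
    have hxc : x.1 ∈ Q.cycles n i := f_mem_cycles W.truncation.incl hx
    have hc : ∀ j, W.proj j n i x.1 ∈ Q.cycles n i := fun j => by
      rw [mem_cycles, ← W.proj_d, d_of_mem_cycles hxc, map_zero]
    have : ∀ j, ∃ u ∈ W.truncation.S n (i + 1), Q.d n (i + 1) i u = W.proj j n i x.1 := by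
      intro j
      have : i < j ∨ ∃ u, Q.d n (i + 1) i u = W.proj j n i x.1 := by
        rcases lt_trichotomy i j with h | rfl | h
        · exact Or.inl h
        · exact Or.inr (h_inj n i _ (hc i) (W.proj_self _ _ _ _) hy)
        · exact Or.inr (h_lt n i j _ h (hc j) (W.proj_self _ _ _ _))
      by_cases hij : i < j
      · exact ⟨0, zero_mem _, by rw [(W.mem_truncation.1 x.2).1 j hij, map_zero]⟩
      · obtain ⟨u, hu⟩ := this.resolve_left hij
        -- A primitive of weight `j ≤ i` has weight below its degree `i + 1`, so it lies in the
        -- truncation with no further condition.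
        refine ⟨W.proj j n (i + 1) u,
          W.mem_truncation_of_lt (W.proj_self j n (i + 1) u) (by omega), ?_⟩
        rw [← W.proj_d, hu, W.proj_self]
    choose u hu hdu using this
    obtain ⟨s, hs⟩ := W.exists_sum n i x.1
    refine ⟨⟨∑ j ∈ s, u j, Submodule.sum_mem _ fun j _ => hu j⟩, Subtype.ext ?_⟩
    change Q.d n (i + 1) i (∑ j ∈ s, u j) = x.1
    rw [map_sum, hs s le_rfl]
    exact Finset.sum_congr rfl fun j _ => hdu j
  have hsurj : ∀ n i z, z ∈ P.cycles n i → ∃ x ∈ W.truncation.operad.cycles n i,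
      W.proj i n i x.1 = x.1 ∧ ∃ y, P.d n (i + 1) i y = ε.f n i x.1 - z := by
    intro n i z hz
    obtain ⟨x, hx, hxi, y, hy⟩ := h_surj n i z hz
    exact ⟨⟨x, W.mem_truncation_of_mem_cycles hxi hx⟩, Subtype.ext hx, hxi, y, hy⟩
  -- Removing the top weight part leaves a cycle to which `key` applies, so `x` and its top weight
  -- part have the same class in `P`. The two maps out of the truncation thus agree on homology.
  have htop : ∀ n i (x : W.truncation.operad.X n i), x ∈ W.truncation.operad.cycles n i →
      ∃ y, P.d n (i + 1) i y = ε.f n i x.1 - ε.f n i (W.proj i n i x.1) := by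
    intro n i x hx
    have hxc : x.1 ∈ Q.cycles n i := f_mem_cycles W.truncation.incl hx
    have hpc : W.proj i n i x.1 ∈ Q.cycles n i := (W.mem_truncation.1 x.2).2
    let x' : W.truncation.operad.X n i :=
      ⟨W.proj i n i x.1, W.mem_truncation_of_mem_cycles (W.proj_self _ _ _ _) hpc⟩
    have hx' : x' ∈ W.truncation.operad.cycles n i := Subtype.ext hpc
    obtain ⟨y, hy⟩ := key n i (x - x') (sub_mem hx hx') ⟨0, by
      rw [map_zero]
      change 0 = ε.f n i (W.proj i n i (x.1 - W.proj i n i x.1))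
      rw [map_sub, W.proj_self, sub_self, map_zero]⟩
    refine ⟨ε.f n (i + 1) y.1, ?_⟩
    rw [← ε.f_d, ← map_sub]
    exact congrArg (ε.f n i) (congrArg Subtype.val hy)
  have w₁ : IsWeakEquiv (W.truncation.incl ≫ ε) := by
    intro n i
    constructor
    · rw [injective_iff_map_eq_zero]
      intro x hx
      obtain ⟨x, rfl⟩ := toHomology_surjective n i x
      rw [homologyMap_toHomology, toHomology_eq_zero] at hx
      obtain ⟨y, hy⟩ := hx
      obtain ⟨y', hy'⟩ := htop n i x.1 x.2
      refine toHomology_eq_zero.2 (key n i x.1 x.2 ⟨y - y', ?_⟩)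
      rw [map_sub, hy, hy']
      exact sub_sub_cancel _ _
    · intro z
      obtain ⟨z, rfl⟩ := toHomology_surjective n i z
      obtain ⟨x, hx, _, y, hy⟩ := hsurj n i z.1 z.2
      exact ⟨toHomology n i ⟨x, hx⟩, toHomology_eq_iff.2 ⟨y, hy⟩⟩
  have w₂ : IsWeakEquiv (W.toHomologyOperad ε) := by
    intro n i
    constructor
    · rw [injective_iff_map_eq_zero]
      intro x hx
      obtain ⟨x, rfl⟩ := toHomology_surjective n i x
      rw [homologyMap_toHomology, toHomology_eq_zero] at hx
      obtain ⟨y, hy⟩ := hx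
      exact toHomology_eq_zero.2 (key n i x.1 x.2 (toHomology_eq_zero.1 hy.symm))
    · intro z
      obtain ⟨⟨z, hz⟩, rfl⟩ := toHomology_surjective n i z
      obtain ⟨z, rfl⟩ := toHomology_surjective n i z
      obtain ⟨x, hx, hxi, y, hy⟩ := hsurj n i z.1 z.2
      refine ⟨toHomology n i ⟨x, hx⟩, congrArg (toHomology n i) (Subtype.ext ?_)⟩
      refine toHomology_eq_iff.2 ⟨y, hy.trans ?_⟩
      rw [← hxi]
      change _ = ε.f n i (W.proj i n i x.1) - z.1
      rw [hxi]
  exact ⟨(Zigzag.refl.bwd _ w₁).fwd _ w₂⟩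

end WeightGrading

end DGOperad

namespace DGOperad

variable {k : Type u} [Field k]

/-! ### Induced weight gradings -/

/-- The weight grading of `Q ⊗ R` induced by one of `Q`. -/
noncomputable def WeightGrading.tensorRight {Q : DGOperad k} (W : WeightGrading Q) (R : Type u)
    [CommRing R] [Algebra k R] : WeightGrading (Q.tensor R) where
  proj j n i := (W.proj j n i).rTensor R
  proj_self j n i x := by
    induction x using TensorProduct.induction_on with
    | zero => simp
    | add x y hx hy => simp only [map_add, hx, hy]
    | tmul x a => simp [W.proj_self]
  proj_ne j j' n i x h := by
    induction x using TensorProduct.induction_on with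
    | zero => simp
    | add x y hx hy => simp only [map_add, hx, hy, add_zero]
    | tmul x a => simp [W.proj_ne _ _ _ _ _ h]
  proj_d w n i j x := by
    induction x using TensorProduct.induction_on with
    | zero => simp
    | add x y hx hy => simp only [map_add, hx, hy]
    | tmul x a => simp [W.proj_d]
  proj_act w n σ i x := by
    induction x using TensorProduct.induction_on with
    | zero => simp
    | add x y hx hy => simp only [map_add, hx, hy]
    | tmul x a => simp [W.proj_act]
  proj_circ := by
    intro l m n h a p q r hd v w x y
    induction x using TensorProduct.induction_on with
    | zero => simp
    | add x x' hx hx' => simp only [map_add, LinearMap.add_apply, hx, hx']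
    | tmul x s =>
      induction y using TensorProduct.induction_on with
      | zero => simp
      | add y y' hy hy' => simp only [map_add, hy, hy']
      | tmul y t => simp [W.proj_circ]
  exists_sum n i x := by
    classical
    induction x using TensorProduct.induction_on with
    | zero => exact ⟨∅, fun t _ => by simp⟩
    | add x y hx hy =>
      obtain ⟨s, hs⟩ := hx
      obtain ⟨s', hs'⟩ := hy
      refine ⟨s ∪ s', fun t ht => ?_⟩
      simp only [map_add, Finset.sum_add_distrib]
      rw [← hs t (Finset.union_subset_left ht), ← hs' t (Finset.union_subset_right ht)]
    | tmul x a =>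
      obtain ⟨s, hs⟩ := W.exists_sum n i x
      refine ⟨s, fun t ht => ?_⟩
      simp only [LinearMap.rTensor_tmul, ← TensorProduct.sum_tmul, ← hs t ht]

/-- The weight grading of `G ⊕ G ds` induced by one of `G`. -/
def WeightGrading.forms {G : DGOperad k} (W : WeightGrading G) (D : Deriv G)
    (hD : ∀ w n i x, W.proj w n i (D.D n i x) = D.D n i (W.proj w n i x)) :
    WeightGrading D.forms where
  proj j n i := LinearMap.prodMap (W.proj j n i) (W.proj j n (i + 1))
  proj_self j n i x := by ext <;> simp [W.proj_self]
  proj_ne j j' n i x h := by ext <;> simp [W.proj_ne _ _ _ _ _ h]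
  proj_d w n i j x := by
    ext
    · simp [W.proj_d]
    · by_cases h : j + 1 = i
      · subst h
        simp [W.proj_d, castSucc_self, hD]
      · simp [W.proj_d, castSucc_ne _ _ _ _ h]
  proj_act w n σ i x := by ext <;> simp [W.proj_act]
  proj_circ := by
    intro l m n h a p q r hd v w x y
    ext <;> simp [W.proj_circ]
  exists_sum n i x := by
    classical
    obtain ⟨s, hs⟩ := W.exists_sum n i x.1
    obtain ⟨s', hs'⟩ := W.exists_sum n (i + 1) x.2
    refine ⟨s ∪ s', fun t ht => ?_⟩
    ext
    · simpa [Prod.fst_sum] using hs t (Finset.union_subset_left ht)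
    · simpa [Prod.snd_sum] using hs' t (Finset.union_subset_right ht)

/-- The weight grading of a suboperad that is stable under the projections. -/
def WeightGrading.sub {Q : DGOperad k} (W : WeightGrading Q) (S : Sub Q)
    (hS : ∀ w n i x, x ∈ S.S n i → W.proj w n i x ∈ S.S n i) : WeightGrading S.operad where
  proj j n i := (W.proj j n i).restrict (hS j n i)
  proj_self j n i x := Subtype.ext (W.proj_self j n i x.1)
  proj_ne j j' n i x h := Subtype.ext (W.proj_ne j j' n i x.1 h)
  proj_d w n i j x := Subtype.ext (W.proj_d w n i j x.1)
  proj_act w n σ i x := Subtype.ext (W.proj_act w n σ i x.1)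
  proj_circ := by
    intro l m n h a p q r hd v w x y
    exact Subtype.ext (W.proj_circ h a hd v w x.1 y.1)
  exists_sum n i x := by
    obtain ⟨s, hs⟩ := W.exists_sum n i x.1
    refine ⟨s, fun t ht => Subtype.ext ?_⟩
    refine (hs t ht).trans ?_
    exact (map_sum (S.S n i).subtype (fun j => (W.proj j n i).restrict (hS j n i) x) t).symm

/-! ### Polynomial paths -/

section Paths

open Polynomial

/-- The derivation of `Q ⊗ k[s]` given by `d/ds`. -/
noncomputable def polyDeriv (Q : DGOperad k) : Deriv (Q.tensor k[X]) where
  D n i := (Polynomial.derivative).lTensor (Q.X n i)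
  D_d n i j x := by
    induction x using TensorProduct.induction_on with
    | zero => simp
    | add x y hx hy => simp only [map_add, hx, hy]
    | tmul x a => simp
  D_act n σ i x := by
    induction x using TensorProduct.induction_on with
    | zero => simp
    | add x y hx hy => simp only [map_add, hx, hy]
    | tmul x a => simp
  D_circ := by
    intro l m n h a p q r hd x y
    induction x using TensorProduct.induction_on with
    | zero => simp
    | add x x' hx hx' => simp only [map_add, LinearMap.add_apply, hx, hx']; abel
    | tmul x s =>
      induction y using TensorProduct.induction_on with
      | zero => simp
      | add y y' hy hy' => simp only [map_add, hy, hy']; abel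
      | tmul y t =>
        simp only [TensorProduct.map₂_apply_tmul, TensorProduct.map_tmul,
          LinearMap.lTensor_tmul, LinearMap.mul_apply', Polynomial.derivative_mul,
          TensorProduct.tmul_add]

/-- Evaluation of polynomial paths. -/
noncomputable def evalPath (Q : DGOperad k) (c : k) : Q.tensor k[X] ⟶ Q :=
  Q.tensorAug (Polynomial.aeval c)

lemma evalPath_tmul (Q : DGOperad k) (c : k) (n i) (x : Q.X n i) (r : k[X]) :
    (Q.evalPath c).f n i (x ⊗ₜ r) = r.eval c • x := by
  rw [evalPath, tensorAug_tmul, Polynomial.coe_aeval_eq_eval]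

/-- The integral of a polynomial from `0`. -/
noncomputable def polyInt : k[X] →ₗ[k] k[X] :=
  Polynomial.lsum fun n => ((n + 1 : k)⁻¹) • Polynomial.monomial (n + 1)

lemma derivative_polyInt [CharZero k] (r : k[X]) : derivative (polyInt r) = r := by
  induction r using Polynomial.induction_on' with
  | add p q hp hq => rw [map_add, map_add, hp, hq]
  | monomial n a =>
    -- Characteristic zero is what allows polynomials to be integrated.
    have : (n + 1 : k) ≠ 0 := by exact_mod_cast n.succ_ne_zero
    simp [polyInt, Polynomial.smul_monomial]
    field_simp

lemma polyInt_derivative [CharZero k] (r : k[X]) :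
    polyInt (derivative r) = r - C (r.eval 0) := by
  induction r using Polynomial.induction_on' with
  | add p q hp hq => simp only [map_add, hp, hq, Polynomial.eval_add]; ring
  | monomial n a =>
    cases n with
    | zero => simp
    | succ n =>
      have : (n + 1 : k) ≠ 0 := by exact_mod_cast n.succ_ne_zero
      simp [polyInt, Polynomial.smul_monomial]
      field_simp

variable (Q : DGOperad k)

/-- The integral of a polynomial path from `0`. -/
noncomputable def pathInt (n i) : Q.X n i ⊗[k] k[X] →ₗ[k] Q.X n i ⊗[k] k[X] :=
  polyInt.lTensor (Q.X n i)

/-- Constant paths. -/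
noncomputable def constPath (n i) : Q.X n i →ₗ[k] Q.X n i ⊗[k] k[X] :=
  (TensorProduct.mk k (Q.X n i) k[X]).flip 1

/-- The path `s ↦ s x`. -/
noncomputable def linPath (n i) : Q.X n i →ₗ[k] Q.X n i ⊗[k] k[X] :=
  (TensorProduct.mk k (Q.X n i) k[X]).flip Polynomial.X

lemma d_linPath (n i j) (x : Q.X n i) :
    (Q.tensor k[X]).d n i j (Q.linPath n i x) = Q.linPath n j (Q.d n i j x) := by
  simp [linPath]

lemma deriv_linPath (n i) (x : Q.X n i) :
    Q.polyDeriv.D n i (Q.linPath n i x) = Q.constPath n i x := by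
  simp [linPath, polyDeriv, constPath]

/-- Such a path starts at `0` and ends at `x`: adding it corrects the value at `1` and keeps the
value at `0`. -/
lemma evalPath_linPath (c : k) (n i) (x : Q.X n i) :
    (Q.evalPath c).f n i (Q.linPath n i x) = c • x :=
  (evalPath_tmul Q c n i x Polynomial.X).trans (by simp)

lemma deriv_pathInt [CharZero k] (n i) (x : Q.X n i ⊗[k] k[X]) :
    Q.polyDeriv.D n i (Q.pathInt n i x) = x := by
  induction x using TensorProduct.induction_on with
  | zero => simp
  | add x y hx hy => simp only [map_add, hx, hy]
  | tmul x a => simp [pathInt, polyDeriv, derivative_polyInt]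

/-- The fundamental theorem of calculus. With `deriv_pathInt` it makes integration a homotopy
contracting the forms on the line onto the constants. -/
lemma pathInt_deriv [CharZero k] (n i) (x : Q.X n i ⊗[k] k[X]) :
    Q.pathInt n i (Q.polyDeriv.D n i x) = x - Q.constPath n i ((Q.evalPath 0).f n i x) := by
  induction x using TensorProduct.induction_on with
  | zero => simp
  | add x y hx hy => simp only [map_add, hx, hy]; abel
  | tmul x a =>
    rw [evalPath_tmul]
    simp only [pathInt, polyDeriv, constPath, LinearMap.lTensor_tmul, polyInt_derivative,
      TensorProduct.tmul_sub, map_smul, LinearMap.flip_apply, TensorProduct.mk_apply,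
      ← TensorProduct.tmul_smul, Polynomial.smul_eq_C_mul, mul_one]

lemma d_pathInt (n i j) (x : Q.X n i ⊗[k] k[X]) :
    (Q.tensor k[X]).d n i j (Q.pathInt n i x) = Q.pathInt n j ((Q.tensor k[X]).d n i j x) := by
  induction x using TensorProduct.induction_on with
  | zero => simp
  | add x y hx hy => simp only [map_add, hx, hy]
  | tmul x a => simp [pathInt]

lemma d_constPath (n i j) (x : Q.X n i) :
    (Q.tensor k[X]).d n i j (Q.constPath n i x) = Q.constPath n j (Q.d n i j x) := by
  simp [constPath]

lemma deriv_constPath (n i) (x : Q.X n i) : Q.polyDeriv.D n i (Q.constPath n i x) = 0 := by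
  simp [constPath, polyDeriv]

lemma evalPath_constPath (c : k) (n i) (x : Q.X n i) :
    (Q.evalPath c).f n i (Q.constPath n i x) = x := by
  exact (evalPath_tmul Q c n i x 1).trans (by simp)

variable {Q}

/-- The homotopy fixed points of an endomorphism `g` of a dg operad: the polynomial paths `x` with
`x 1 = g (x 0)`. -/
noncomputable def fixSub (g : Q ⟶ Q) : Sub Q.polyDeriv.forms where
  -- Restricting a form to an endpoint kills `ds`, so the condition bears on the first component
  -- only.
  S n i := (LinearMap.ker ((Q.evalPath 1).f n i - (g.f n i) ∘ₗ (Q.evalPath 0).f n i)).comap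
    (LinearMap.fst k (Q.X n i ⊗[k] k[X]) (Q.X n (i + 1) ⊗[k] k[X]))
  d_mem n i j x h hx := by
    simp only [Submodule.mem_comap, LinearMap.mem_ker, LinearMap.sub_apply,
      LinearMap.comp_apply, sub_eq_zero, LinearMap.fst_apply] at hx ⊢
    refine ((Q.evalPath 1).f_d n i j x.1).trans ?_
    rw [hx, ← g.f_d]
    exact congrArg (g.f n j) ((Q.evalPath 0).f_d n i j x.1).symm
  act_mem n σ i x hx := by
    simp only [Submodule.mem_comap, LinearMap.mem_ker, LinearMap.sub_apply,
      LinearMap.comp_apply, sub_eq_zero, LinearMap.fst_apply] at hx ⊢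
    refine ((Q.evalPath 1).f_act n σ i x.1).trans ?_
    rw [hx, ← g.f_act]
    exact congrArg (g.f n i) ((Q.evalPath 0).f_act n σ i x.1).symm
  circ_mem := by
    intro l m n h a p q r hd x y hx hy
    simp only [Submodule.mem_comap, LinearMap.mem_ker, LinearMap.sub_apply,
      LinearMap.comp_apply, sub_eq_zero, LinearMap.fst_apply] at hx hy ⊢
    refine ((Q.evalPath 1).f_circ h a hd x.1 y.1).trans ?_
    rw [hx, hy, ← g.f_circ]
    exact congrArg (g.f n r) ((Q.evalPath 0).f_circ h a hd x.1 y.1).symm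

lemma mem_fixSub {g : Q ⟶ Q} {n i} {x : Q.polyDeriv.forms.X n i} : x ∈ (fixSub g).S n i ↔
    (Q.evalPath 1).f n i x.1 = g.f n i ((Q.evalPath 0).f n i x.1) := by
  simp only [fixSub, Submodule.mem_comap, LinearMap.mem_ker, LinearMap.sub_apply,
      LinearMap.comp_apply, sub_eq_zero, LinearMap.fst_apply]

/-- Forgetting the component at `ds`. -/
def formsFst {G : DGOperad k} (D : Deriv G) : D.forms ⟶ G where
  f n i := LinearMap.fst k (G.X n i) (G.X n (i + 1))
  f_d _ _ _ _ := rfl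
  f_act _ _ _ _ := rfl
  f_circ _ _ _ _ _ _ _ _ := rfl

lemma forms_d_snd {G : DGOperad k} (D : Deriv G) (n : ℕ) (j : ℤ) (x : D.forms.X n (j + 1)) :
    (D.forms.d n (j + 1) j x).2 =
      G.d n (j + 1 + 1) (j + 1) x.2 + (((j + 1).negOnePow : ℤˣ) : ℤ) • D.D n (j + 1) x.1 := by
  simp [castSucc_self]

section Weights

variable (W : WeightGrading Q)

lemma evalPath_proj (c : k) (w n i) (x : Q.X n i ⊗[k] k[X]) :
    (Q.evalPath c).f n i ((W.tensorRight k[X]).proj w n i x) =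
      W.proj w n i ((Q.evalPath c).f n i x) := by
  induction x using TensorProduct.induction_on with
  | zero => simp
  | add x y hx hy => simp only [map_add, hx, hy]
  | tmul x a =>
    rw [evalPath_tmul, map_smul]
    exact evalPath_tmul Q c n i (W.proj w n i x) a

lemma polyDeriv_proj (w n i) (x : Q.X n i ⊗[k] k[X]) :
    (W.tensorRight k[X]).proj w n i (Q.polyDeriv.D n i x) =
      Q.polyDeriv.D n i ((W.tensorRight k[X]).proj w n i x) := by
  induction x using TensorProduct.induction_on with
  | zero => simp
  | add x y hx hy => simp only [map_add, hx, hy]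
  | tmul x a => rfl

lemma pathInt_proj (w n i) (x : Q.X n i ⊗[k] k[X]) :
    (W.tensorRight k[X]).proj w n i (Q.pathInt n i x) =
      Q.pathInt n i ((W.tensorRight k[X]).proj w n i x) := by
  induction x using TensorProduct.induction_on with
  | zero => simp
  | add x y hx hy => simp only [map_add, hx, hy]
  | tmul x a => rfl

lemma constPath_proj (w n i) (x : Q.X n i) :
    (W.tensorRight k[X]).proj w n i (Q.constPath n i x) =
      Q.constPath n i (W.proj w n i x) := rfl

lemma linPath_proj (w n i) (x : Q.X n i) :
    (W.tensorRight k[X]).proj w n i (Q.linPath n i x) =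
      Q.linPath n i (W.proj w n i x) := rfl

/-- The weight grading of the homotopy fixed points. -/
noncomputable def fixWeight {g : Q ⟶ Q}
    (hg : ∀ w n i x, W.proj w n i (g.f n i x) = g.f n i (W.proj w n i x)) :
    WeightGrading (fixSub g).operad :=
  ((W.tensorRight k[X]).forms Q.polyDeriv (polyDeriv_proj W)).sub (fixSub g) (by
    intro w n i x hx
    rw [mem_fixSub] at hx ⊢
    refine (evalPath_proj W 1 w n i x.1).trans ?_
    rw [hx, hg]
    exact congrArg (g.f n i) (evalPath_proj W 0 w n i x.1).symm)

end Weights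

end Paths

end DGOperad

namespace DGOperad

variable {k : Type u} [Field k]

/-! ### Formality from homotopy fixed points -/

open Polynomial in
/-- A criterion for formality in terms of an endomorphism `g` of a weight graded dg operad `Q`,
whose fixed points on homology are those of the homology of `P`. -/
theorem isFormal_of_fixedPoints [CharZero k] {P Q : DGOperad k} (W : WeightGrading Q) (g : Q ⟶ Q)
    (hg : ∀ w n i x, W.proj w n i (g.f n i x) = g.f n i (W.proj w n i x)) (ε : Q ⟶ P)
    (h_coker : ∀ n i j, j ≤ i → ∀ c ∈ Q.cycles n (i + 1), W.proj j n (i + 1) c = c →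
      ∃ z ∈ Q.cycles n (i + 1), ∃ m, c = z - g.f n (i + 1) z + Q.d n (i + 1 + 1) (i + 1) m)
    (h_ker : ∀ n i j, j < i → ∀ c ∈ Q.cycles n i, W.proj j n i c = c →
      (∃ m, Q.d n (i + 1) i m = c - g.f n i c) → ∃ y, Q.d n (i + 1) i y = c)
    (h_inj : ∀ n i, ∀ c ∈ Q.cycles n i, W.proj i n i c = c →
      (∃ m, Q.d n (i + 1) i m = c - g.f n i c) → (∃ y, P.d n (i + 1) i y = ε.f n i c) →
      ∃ y, Q.d n (i + 1) i y = c)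
    (h_surj : ∀ n i, ∀ z ∈ P.cycles n i, ∃ c ∈ Q.cycles n i, W.proj i n i c = c ∧
      (∃ m, Q.d n (i + 1) i m = c - g.f n i c) ∧ ∃ y, P.d n (i + 1) i y = ε.f n i c - z) :
    P.IsFormal := by
  -- Injectivity of evaluation at `0` on homology in weights at most the degree: the obstruction to
  -- bounding lies in the cokernel of `1 - g` one degree higher, which `h_coker` makes zero.
  have key : ∀ n j w (x : (fixSub g).operad.X n (j + 1)), w ≤ j + 1 →
      x ∈ (fixSub g).operad.cycles n (j + 1) →
      (fixWeight W hg).proj w n (j + 1) x = x →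
      (∀ c ∈ Q.cycles n (j + 1), W.proj w n (j + 1) c = c →
        (∃ m, Q.d n (j + 1 + 1) (j + 1) m = c - g.f n (j + 1) c) →
        c = (Q.evalPath 0).f n (j + 1) x.1.1 →
        ∃ y, Q.d n (j + 1 + 1) (j + 1) y = c) →
      ∃ y, (fixSub g).operad.d n (j + 1 + 1) (j + 1) y = x := by
    intro n j w x hw hx hxw hc
    obtain ⟨⟨a, b⟩, hab⟩ := x
    rw [mem_fixSub] at hab
    change (Q.evalPath 1).f n (j + 1) a = g.f n (j + 1) ((Q.evalPath 0).f n (j + 1) a) at hab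
    have hx' := congrArg Subtype.val (d_of_mem_cycles (j := j) hx)
    have ha : (Q.tensor k[X]).d n (j + 1) j a = 0 := congrArg Prod.fst hx'
    have hb := (forms_d_snd Q.polyDeriv n j (a, b)).symm.trans (congrArg Prod.snd hx')
    change (Q.tensor k[X]).d n (j + 1 + 1) (j + 1) b +
      (((j + 1).negOnePow : ℤˣ) : ℤ) • Q.polyDeriv.D n (j + 1) a = 0 at hb
    have hxw' := congrArg Subtype.val hxw
    have hwa : (W.tensorRight k[X]).proj w n (j + 1) a = a := congrArg Prod.fst hxw'
    have hwb : (W.tensorRight k[X]).proj w n (j + 1 + 1) b = b := congrArg Prod.snd hxw'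
    have hs' : (((j + 1 + 1).negOnePow : ℤˣ) : ℤ) = -(((j + 1).negOnePow : ℤˣ) : ℤ) := by
      simp [Int.negOnePow_succ]
    have hs : (((j + 1).negOnePow : ℤˣ) : ℤ) * (((j + 1).negOnePow : ℤˣ) : ℤ) = 1 := by
      simp [← Units.val_mul]
    generalize hsd : (((j + 1).negOnePow : ℤˣ) : ℤ) = s at hb hs hs'
    have hdb : (Q.tensor k[X]).d n (j + 1 + 1) (j + 1) b = -(s • Q.polyDeriv.D n (j + 1) a) :=
      eq_neg_of_add_eq_zero_left hb
    -- Integrating the equation `d b = ∓ a'` shows that `a` differs from the constant path at `a(0)`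
    -- by a boundary.
    have hJ : s • Q.pathInt n (j + 1) ((Q.tensor k[X]).d n (j + 1 + 1) (j + 1) b) =
        Q.constPath n (j + 1) ((Q.evalPath 0).f n (j + 1) a) - a := by
      rw [hdb, map_neg, map_zsmul, pathInt_deriv, smul_neg, smul_smul, hs, one_smul, neg_sub]
    set c := (Q.evalPath 0).f n (j + 1) a with hcdef
    have hcc : c ∈ Q.cycles n (j + 1) := mem_cycles_of_d rfl (by
      rw [hcdef, ← (Q.evalPath 0).f_d, ha, map_zero])
    have hcw : W.proj w n (j + 1) c = c := by
      rw [hcdef, ← evalPath_proj, hwa]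
    -- Evaluating that homotopy at `1`, where `a(1) = g c`, exhibits `c - g c` as a boundary.
    obtain ⟨y, hy⟩ := hc c hcc hcw
      ⟨s • (Q.evalPath 1).f n (j + 1 + 1) (Q.pathInt n (j + 1 + 1) b), by
        rw [map_zsmul, ← (Q.evalPath 1).f_d, d_pathInt, ← map_zsmul, hJ, map_sub,
          evalPath_constPath, hab]⟩ rfl
    set v := W.proj w n (j + 1 + 1) y with hv
    have hdv : Q.d n (j + 1 + 1) (j + 1) v = c := by rw [hv, ← W.proj_d, hy, hcw]
    -- The form `(u, 0)` bounds `(a, b)` among all paths; only the condition at the endpoints may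
    -- fail, with the defect `e`.
    set u := Q.constPath n (j + 1 + 1) v - s • Q.pathInt n (j + 1 + 1) b with hu
    have hdu : (Q.tensor k[X]).d n (j + 1 + 1) (j + 1) u = a := by
      rw [hu, map_sub, map_zsmul, d_pathInt, hJ, d_constPath, hdv, sub_sub_cancel]
    have hDu : Q.polyDeriv.D n (j + 1 + 1) u = -(s • b) := by
      rw [hu, map_sub, map_zsmul, deriv_pathInt, deriv_constPath, zero_sub]
    have huw : (W.tensorRight k[X]).proj w n (j + 1 + 1) u = u := by
      rw [hu, map_sub, map_zsmul, pathInt_proj, hwb, constPath_proj, hv, W.proj_self]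
    set e := (Q.evalPath 1).f n (j + 1 + 1) u - g.f n (j + 1 + 1) ((Q.evalPath 0).f n (j + 1 + 1) u)
      with he
    have hec : -e ∈ Q.cycles n (j + 1 + 1) := neg_mem (mem_cycles_of_d rfl (by
      rw [he, map_sub, ← g.f_d, ← (Q.evalPath 1).f_d, ← (Q.evalPath 0).f_d, hdu, hab, sub_self]))
    have hew : W.proj w n (j + 1 + 1) (-e) = -e := by
      rw [map_neg, he, map_sub, hg, ← evalPath_proj, ← evalPath_proj, huw]
    obtain ⟨z, hz, m, hm⟩ := h_coker n (j + 1) w hw (-e) hec hew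
    -- The constant path at `z` and the path `s ↦ s • d m` cancel the defect `-e = z - g z + d m`.
    -- The term in `ds` compensates the derivative of the second path, so the boundary is unchanged.
    let q : Q.polyDeriv.forms.X n (j + 1 + 1) :=
      (u + Q.constPath n _ z + Q.linPath n _ (Q.d n (j + 1 + 1 + 1) (j + 1 + 1) m),
        s • Q.constPath n _ m)
    have hq : q ∈ (fixSub g).S n (j + 1 + 1) := by
      rw [mem_fixSub]
      change (Q.evalPath 1).f n (j + 1 + 1) (u + Q.constPath n _ z + Q.linPath n _ _) =
        g.f n (j + 1 + 1) ((Q.evalPath 0).f n (j + 1 + 1)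
          (u + Q.constPath n _ z + Q.linPath n _ _))
      rw [map_add, map_add, map_add ((Q.evalPath 0).f n (j + 1 + 1)),
        map_add ((Q.evalPath 0).f n (j + 1 + 1)), evalPath_constPath, evalPath_constPath,
        evalPath_linPath, evalPath_linPath, one_smul, zero_smul, add_zero, map_add]
      rw [← sub_eq_zero]
      rw [he] at hm
      rw [← sub_eq_zero] at hm
      rw [← neg_eq_zero, ← hm]
      abel
    refine ⟨⟨q, hq⟩, Subtype.ext ?_⟩
    change Q.polyDeriv.forms.d n (j + 1 + 1) (j + 1) q = (a, b)
    refine Prod.ext ?_ ?_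
    · change (Q.tensor k[X]).d n (j + 1 + 1) (j + 1) (u + Q.constPath n _ z + Q.linPath n _ _) = a
      rw [map_add, map_add, hdu, d_constPath, d_linPath, d_of_mem_cycles hz, Q.d_comp_d, map_zero,
        map_zero, add_zero, add_zero]
    · rw [forms_d_snd]
      change (Q.tensor k[X]).d n _ _ (s • Q.constPath n _ m) + _ •
        Q.polyDeriv.D n _ (u + Q.constPath n _ z + Q.linPath n _ _) = b
      rw [hs', map_add, map_add, hDu, deriv_constPath, deriv_linPath, map_zsmul, d_constPath,
        add_zero, smul_add, smul_neg, neg_smul, neg_smul, neg_neg, smul_smul, hs, one_smul]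
      abel
  refine (fixWeight W hg).isFormal
    ((fixSub g).incl ≫ formsFst Q.polyDeriv ≫ Q.evalPath 0 ≫ ε) ?_ ?_ ?_
  · intro n i w x hw hx hxw
    obtain ⟨j, rfl⟩ : ∃ j, i = j + 1 := ⟨i - 1, by omega⟩
    exact key n j w x hw.le hx hxw fun c hc hcw hm _ => h_ker n _ w hw c hc hcw hm
  · intro n i x hx hxw hy
    obtain ⟨j, rfl⟩ : ∃ j, i = j + 1 := ⟨i - 1, by omega⟩
    exact key n j (j + 1) x le_rfl hx hxw fun c hc hcw hm hcx =>
      h_inj n _ c hc hcw hm (by rw [hcx]; exact hy)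
  · intro n i z hz
    obtain ⟨j, rfl⟩ : ∃ j, i = j + 1 := ⟨i - 1, by omega⟩
    obtain ⟨c, hc, hcw, ⟨m', hm'⟩, hy⟩ := h_surj n _ z hz
    set m := W.proj (j + 1) n (j + 1 + 1) m' with hmdef
    have hm : Q.d n (j + 1 + 1) (j + 1) m = c - g.f n (j + 1) c := by
      rw [hmdef, ← W.proj_d, hm', map_sub, hg, hcw]
    have hmw : W.proj (j + 1) n (j + 1 + 1) m = m := W.proj_self _ _ _ _
    set s := (((j + 1).negOnePow : ℤˣ) : ℤ) with hs
    -- The straight path from `c` to `c - d m = g c`, completed by a `ds` term that makes it a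
    -- cycle.
    let q : Q.polyDeriv.forms.X n (j + 1) :=
      (Q.constPath n _ c - Q.linPath n _ (Q.d n (j + 1 + 1) (j + 1) m), s • Q.constPath n _ m)
    have hq0 : (Q.evalPath 0).f n (j + 1)
        (Q.constPath n _ c - Q.linPath n _ (Q.d n (j + 1 + 1) (j + 1) m)) = c := by
      rw [map_sub, evalPath_constPath, evalPath_linPath, zero_smul, sub_zero]
    have hq : q ∈ (fixSub g).S n (j + 1) := by
      rw [mem_fixSub]
      change (Q.evalPath 1).f n (j + 1) (Q.constPath n _ c - Q.linPath n _ _) =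
        g.f n (j + 1) ((Q.evalPath 0).f n (j + 1) (Q.constPath n _ c - Q.linPath n _ _))
      rw [hq0, map_sub, evalPath_constPath, evalPath_linPath, one_smul, hm, sub_sub_cancel]
    refine ⟨⟨q, hq⟩, mem_cycles_of_d (j := j) rfl (Subtype.ext ?_), Subtype.ext ?_, ?_⟩
    · change Q.polyDeriv.forms.d n (j + 1) j q = 0
      refine Prod.ext ?_ ?_
      · change (Q.tensor k[X]).d n (j + 1) j (Q.constPath n _ c - Q.linPath n _ _) = 0
        rw [map_sub, d_constPath, d_linPath, d_of_mem_cycles hc, Q.d_comp_d, map_zero, map_zero,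
          sub_zero]
      · rw [forms_d_snd]
        change (Q.tensor k[X]).d n _ _ (s • Q.constPath n _ m) + s •
          Q.polyDeriv.D n _ (Q.constPath n _ c - Q.linPath n _ _) = 0
        rw [map_sub, deriv_constPath, deriv_linPath, map_zsmul, d_constPath, zero_sub, smul_neg,
          add_neg_cancel]
    · refine Prod.ext ?_ ?_
      · change (W.tensorRight k[X]).proj (j + 1) n _ (Q.constPath n _ c - Q.linPath n _ _) =
          Q.constPath n _ c - Q.linPath n _ _
        rw [map_sub, constPath_proj, linPath_proj, W.proj_d, hcw, hmw]
      · change (W.tensorRight k[X]).proj (j + 1) n _ (s • Q.constPath n _ m) =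
          s • Q.constPath n _ m
        rw [map_zsmul, constPath_proj, hmw]
    · obtain ⟨y, hy⟩ := hy
      refine ⟨y, hy.trans ?_⟩
      change _ = ε.f n (j + 1) ((Q.evalPath 0).f n (j + 1)
        (Q.constPath n _ c - Q.linPath n _ (Q.d n (j + 1 + 1) (j + 1) m))) - z
      rw [hq0]

end DGOperad

/-! ### Coefficients in a weight graded commutative algebra -/

/-- A grading of a commutative algebra by weights, given by the projections to the homogeneous
parts. -/
structure AlgWeight (k : Type u) [Field k] (A : Type u) [CommRing A] [Algebra k A] where
  proj : ℤ → A →ₗ[k] A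
  proj_self : ∀ j x, proj j (proj j x) = proj j x
  proj_ne : ∀ j j' x, j ≠ j' → proj j (proj j' x) = 0
  proj_mul : ∀ v w x y, proj (v + w) (proj v x * proj w y) = proj v x * proj w y
  exists_sum : ∀ x, ∃ s : Finset ℤ, ∀ t, s ⊆ t → x = ∑ j ∈ t, proj j x

namespace DGOperad

variable {k : Type u} [Field k]

/-- The weight grading of `P ⊗ A` induced by one of `A`. -/
noncomputable def tensorWeight (P : DGOperad k) {A : Type u} [CommRing A] [Algebra k A]
    (W : AlgWeight k A) : WeightGrading (P.tensor A) where
  proj j n i := (W.proj j).lTensor (P.X n i)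
  proj_self j n i x := by
    induction x using TensorProduct.induction_on with
    | zero => simp
    | add x y hx hy => simp only [map_add, hx, hy]
    | tmul x a => simp [W.proj_self]
  proj_ne j j' n i x h := by
    induction x using TensorProduct.induction_on with
    | zero => simp
    | add x y hx hy => simp only [map_add, hx, hy, add_zero]
    | tmul x a => simp [W.proj_ne _ _ _ h]
  proj_d w n i j x := by
    induction x using TensorProduct.induction_on with
    | zero => simp
    | add x y hx hy => simp only [map_add, hx, hy]
    | tmul x a => simp
  proj_act w n σ i x := by
    induction x using TensorProduct.induction_on with
    | zero => simp
    | add x y hx hy => simp only [map_add, hx, hy]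
    | tmul x a => simp
  proj_circ := by
    intro l m n h a p q r hd v w x y
    induction x using TensorProduct.induction_on with
    | zero => simp
    | add x x' hx hx' => simp only [map_add, LinearMap.add_apply, hx, hx']
    | tmul x s =>
      induction y using TensorProduct.induction_on with
      | zero => simp
      | add y y' hy hy' => simp only [map_add, hy, hy']
      | tmul y t => simp [W.proj_mul]
  exists_sum n i x := by
    classical
    induction x using TensorProduct.induction_on with
    | zero => exact ⟨∅, fun t _ => by simp⟩
    | add x y hx hy =>
      obtain ⟨s, hs⟩ := hx
      obtain ⟨s', hs'⟩ := hy
      refine ⟨s ∪ s', fun t ht => ?_⟩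
      simp only [map_add, Finset.sum_add_distrib]
      rw [← hs t (Finset.union_subset_left ht), ← hs' t (Finset.union_subset_right ht)]
    | tmul x a =>
      obtain ⟨s, hs⟩ := W.exists_sum a
      refine ⟨s, fun t ht => ?_⟩
      simp only [LinearMap.lTensor_tmul, ← TensorProduct.tmul_sum, ← hs t ht]

/-! ### The homology of `P ⊗ A` -/

section Kunneth

variable (P : DGOperad k) (A : Type u) [CommRing A] [Algebra k A]

/-- The cycles of `P ⊗ A` given by elements of `Z ⊗ A`, where `Z` are the cycles of `P`. -/
noncomputable def tensorCycles (n : ℕ) (i : ℤ) :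
    P.cycles n i ⊗[k] A →ₗ[k] (P.tensor A).cycles n i :=
  ((P.cycles n i).subtype.rTensor A).codRestrict _ (fun x => by
    rw [mem_cycles]
    induction x using TensorProduct.induction_on with
    | zero => simp
    | add x y hx hy => rw [map_add, map_add, hx, hy, add_zero]
    | tmul x a => simp [d_of_mem_cycles x.2])

/-- Flatness over a field: tensoring with `A` preserves kernels. -/
lemma tensorCycles_bijective (n : ℕ) (i : ℤ) : Function.Bijective (P.tensorCycles A n i) := by
  constructor
  · intro x y h
    exact Module.Flat.rTensor_preserves_injective_linearMap (M := A) (P.cycles n i).subtype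
      Subtype.val_injective (congrArg Subtype.val h)
  · rintro ⟨x, hx⟩
    have := Module.Flat.rTensor_exact A (LinearMap.exact_subtype_ker_map (P.d n i (i - 1)))
    obtain ⟨y, hy⟩ := (this x).1 hx
    exact ⟨y, Subtype.ext hy⟩

/-- The class of a cycle of `P ⊗ A` in `H(P) ⊗ A`. -/
noncomputable def tensorClass (n : ℕ) (i : ℤ) :
    (P.tensor A).cycles n i →ₗ[k] P.Homology n i ⊗[k] A :=
  (toHomology n i).rTensor A ∘ₗ
    (LinearEquiv.ofBijective _ (P.tensorCycles_bijective A n i)).symm.toLinearMap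

lemma tensorClass_tensorCycles {n : ℕ} {i : ℤ} (x : P.cycles n i ⊗[k] A) :
    P.tensorClass A n i (P.tensorCycles A n i x) = (toHomology n i).rTensor A x :=
  congrArg _ ((LinearEquiv.ofBijective _ (P.tensorCycles_bijective A n i)).symm_apply_apply x)

lemma tensorClass_surjective (n : ℕ) (i : ℤ) : Function.Surjective (P.tensorClass A n i) := by
  intro h
  obtain ⟨x, rfl⟩ := LinearMap.rTensor_surjective A (toHomology_surjective (P := P) n i) h
  exact ⟨_, P.tensorClass_tensorCycles A x⟩

/-- Right exactness of the tensor product, applied to boundaries, cycles and homology. With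
`tensorClass_surjective` this identifies the homology of `P ⊗ A` with `H(P) ⊗ A`. -/
lemma tensorClass_eq_zero {n : ℕ} {i : ℤ} (x : (P.tensor A).cycles n i) :
    P.tensorClass A n i x = 0 ↔ ∃ y, (P.tensor A).d n (i + 1) i y = x.1 := by
  obtain ⟨x, rfl⟩ := (P.tensorCycles_bijective A n i).2 x
  rw [tensorClass_tensorCycles]
  let d' : P.X n (i + 1) →ₗ[k] P.cycles n i :=
    (P.d n (i + 1) i).codRestrict _ fun x => d_mem_cycles x
  have hex : Function.Exact d' (toHomology (P := P) n i) := by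
    intro z
    rw [toHomology_eq_zero]
    exact ⟨fun ⟨y, hy⟩ => ⟨y, Subtype.ext hy⟩, fun ⟨y, hy⟩ => ⟨y, congrArg Subtype.val hy⟩⟩
  have hd : ∀ y, (P.tensorCycles A n i (d'.rTensor A y)).1 =
      (P.tensor A).d n (i + 1) i y := by
    intro y
    induction y using TensorProduct.induction_on with
    | zero => simp
    | add x y hx hy => rw [map_add, map_add, map_add, ← hx, ← hy]; rfl
    | tmul x a => rfl
  refine (rTensor_exact A hex (toHomology_surjective n i) x).trans ?_
  constructor
  · rintro ⟨y, rfl⟩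
    exact ⟨y, (hd y).symm⟩
  · rintro ⟨y, hy⟩
    exact ⟨y, (P.tensorCycles_bijective A n i).1 (Subtype.ext ((hd y).trans hy))⟩

variable {P A}

/-- Naturality of the Künneth map. With `tensorClass_proj` and `tensorClass_aug` it reduces the
hypotheses of `isFormal_of_fixedPoints` to linear algebra in `H(P) ⊗ A`. -/
lemma tensorClass_map {P' : DGOperad k} {B : Type u} [CommRing B] [Algebra k B] (F : P ⟶ P')
    (χ : A →ₐ[k] B) {n : ℕ} {i : ℤ} (x : (P.tensor A).cycles n i) :
    P'.tensorClass B n i ⟨(tensorMap F χ).f n i x.1, f_mem_cycles _ x.2⟩ =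
      TensorProduct.map (homologyMap F n i) χ.toLinearMap (P.tensorClass A n i x) := by
  obtain ⟨x, rfl⟩ := (P.tensorCycles_bijective A n i).2 x
  rw [tensorClass_tensorCycles]
  induction x using TensorProduct.induction_on with
  | zero =>
    simp only [map_zero]
    exact (congrArg (P'.tensorClass B n i) (Subtype.ext (map_zero _))).trans (map_zero _)
  | add x y hx hy =>
    rw [map_add, map_add, map_add, ← hx, ← hy, ← map_add (P'.tensorClass B n i)]
    refine congrArg _ (Subtype.ext ?_)
    exact map_add _ _ _
  | tmul x a =>
    exact P'.tensorClass_tensorCycles B ((⟨F.f n i x.1, f_mem_cycles F x.2⟩ : P'.cycles n i) ⊗ₜ χ a)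

lemma proj_mem_cycles {Q : DGOperad k} (W : WeightGrading Q) (w : ℤ) {n : ℕ} {i : ℤ} {x : Q.X n i}
    (hx : x ∈ Q.cycles n i) : W.proj w n i x ∈ Q.cycles n i := by
  rw [mem_cycles, ← W.proj_d, d_of_mem_cycles hx, map_zero]

lemma tensorClass_proj (W : AlgWeight k A) (w : ℤ) {n : ℕ} {i : ℤ} (x : (P.tensor A).cycles n i) :
    P.tensorClass A n i ⟨(P.tensorWeight W).proj w n i x.1, proj_mem_cycles _ _ x.2⟩ =
      (W.proj w).lTensor _ (P.tensorClass A n i x) := by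
  obtain ⟨x, rfl⟩ := (P.tensorCycles_bijective A n i).2 x
  rw [tensorClass_tensorCycles]
  induction x using TensorProduct.induction_on with
  | zero =>
    simp only [map_zero]
    exact (congrArg (P.tensorClass A n i) (Subtype.ext (map_zero _))).trans (map_zero _)
  | add x y hx hy =>
    rw [map_add, map_add, map_add, ← hx, ← hy, ← map_add (P.tensorClass A n i)]
    refine congrArg _ (Subtype.ext ?_)
    exact map_add _ _ _
  | tmul x a => exact P.tensorClass_tensorCycles A (x ⊗ₜ W.proj w a)

/-- The map `V ⊗ A → V` given by an augmentation of `A`. -/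
noncomputable def augMap (V : Type u) [AddCommGroup V] [Module k V] (χ : A →ₐ[k] k) :
    V ⊗[k] A →ₗ[k] V := (TensorProduct.rid k V).toLinearMap ∘ₗ χ.toLinearMap.lTensor V

lemma augMap_tmul {V : Type u} [AddCommGroup V] [Module k V] (χ : A →ₐ[k] k) (v : V) (a : A) :
    augMap V χ (v ⊗ₜ a) = χ a • v := by simp [augMap]

lemma tensorClass_aug (χ : A →ₐ[k] k) {n : ℕ} {i : ℤ} (x : (P.tensor A).cycles n i) :
    toHomology n i ⟨(P.tensorAug χ).f n i x.1, f_mem_cycles _ x.2⟩ =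
      augMap _ χ (P.tensorClass A n i x) := by
  obtain ⟨x, rfl⟩ := (P.tensorCycles_bijective A n i).2 x
  rw [tensorClass_tensorCycles]
  induction x using TensorProduct.induction_on with
  | zero =>
    simp only [map_zero]
    exact (congrArg (toHomology (P := P) n i) (Subtype.ext (map_zero _))).trans (map_zero _)
  | add x y hx hy =>
    rw [map_add, map_add, map_add, ← hx, ← hy, ← map_add (toHomology (P := P) n i)]
    refine congrArg _ (Subtype.ext ?_)
    exact map_add _ _ _
  | tmul x a =>
    rw [LinearMap.rTensor_tmul, augMap_tmul, ← map_smul]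
    exact congrArg _ (Subtype.ext (tensorAug_tmul _ _ _ _ _ _))

end Kunneth

/-- A criterion for the formality of `P` in terms of the homology of an endomorphism `f`. -/
theorem isFormal_of_endo [CharZero k] {P : DGOperad k} (f : P ⟶ P) {A : Type u} [CommRing A]
    [Algebra k A] (W : AlgWeight k A) (θ : A →ₐ[k] A) (hθ : ∀ w x, W.proj w (θ x) = θ (W.proj w x))
    (χ : A →ₐ[k] k)
    (h_coker : ∀ n i j, j ≠ i → ∀ h : P.Homology n i ⊗[k] A, (W.proj j).lTensor _ h = h →
      ∃ h', h = h' - TensorProduct.map (homologyMap f n i) θ.toLinearMap h')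
    (h_ker : ∀ n i j, j ≠ i → ∀ h : P.Homology n i ⊗[k] A, (W.proj j).lTensor _ h = h →
      h = TensorProduct.map (homologyMap f n i) θ.toLinearMap h → h = 0)
    (h_inj : ∀ n i, ∀ h : P.Homology n i ⊗[k] A, (W.proj i).lTensor _ h = h →
      h = TensorProduct.map (homologyMap f n i) θ.toLinearMap h → augMap _ χ h = 0 → h = 0)
    (h_surj : ∀ n i, ∀ v : P.Homology n i, ∃ h : P.Homology n i ⊗[k] A,
      (W.proj i).lTensor _ h = h ∧ h = TensorProduct.map (homologyMap f n i) θ.toLinearMap h ∧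
        augMap _ χ h = v) : P.IsFormal := by
  have hg : ∀ w n i x, (P.tensorWeight W).proj w n i ((tensorMap f θ).f n i x) =
      (tensorMap f θ).f n i ((P.tensorWeight W).proj w n i x) := by
    intro w n i x
    induction x using TensorProduct.induction_on with
    | zero => simp
    | add x y hx hy => simp only [map_add, hx, hy]
    | tmul x a =>
      change f.f n i x ⊗ₜ[k] W.proj w (θ a) = f.f n i x ⊗ₜ[k] θ (W.proj w a)
      rw [hθ]
  have hproj : ∀ {w n i} (x : (P.tensor A).cycles n i), (P.tensorWeight W).proj w n i x.1 = x.1 →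
      (W.proj w).lTensor _ (P.tensorClass A n i x) = P.tensorClass A n i x := by
    intro w n i x hx
    rw [← tensorClass_proj]
    exact congrArg _ (Subtype.ext hx)
  have hfix : ∀ {n i} (x : (P.tensor A).cycles n i),
      (∃ m, (P.tensor A).d n (i + 1) i m = x.1 - (tensorMap f θ).f n i x.1) ↔
      P.tensorClass A n i x =
        TensorProduct.map (homologyMap f n i) θ.toLinearMap (P.tensorClass A n i x) := by
    intro n i x
    rw [← tensorClass_map, ← sub_eq_zero, ← map_sub, tensorClass_eq_zero]
    rfl
  have haug : ∀ {n i} (x : (P.tensor A).cycles n i) (z : P.cycles n i),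
      (∃ y, P.d n (i + 1) i y = (P.tensorAug χ).f n i x.1 - z.1) ↔
      augMap _ χ (P.tensorClass A n i x) = toHomology n i z := by
    intro n i x z
    rw [← tensorClass_aug, toHomology_eq_iff]
  refine isFormal_of_fixedPoints (P.tensorWeight W) (tensorMap f θ) hg (P.tensorAug χ)
    ?_ ?_ ?_ ?_
  · intro n i j hj c hc hw
    -- The cokernel is taken in degree `i + 1`, which differs from every weight `j ≤ i`.
    obtain ⟨h', hh'⟩ := h_coker n (i + 1) j (by omega) _ (hproj ⟨c, hc⟩ hw)
    obtain ⟨z, rfl⟩ := P.tensorClass_surjective A n (i + 1) h'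
    rw [← tensorClass_map, ← map_sub, ← sub_eq_zero, ← map_sub, tensorClass_eq_zero] at hh'
    obtain ⟨m, hm⟩ := hh'
    refine ⟨z.1, z.2, m, ?_⟩
    rw [hm]
    exact (add_sub_cancel _ _).symm
  · intro n i j hj c hc hw hm
    exact (P.tensorClass_eq_zero A ⟨c, hc⟩).1 (h_ker n i j (by omega) _ (hproj ⟨c, hc⟩ hw)
      ((hfix ⟨c, hc⟩).1 hm))
  · intro n i c hc hw hm hy
    refine (P.tensorClass_eq_zero A ⟨c, hc⟩).1 (h_inj n i _ (hproj ⟨c, hc⟩ hw)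
      ((hfix ⟨c, hc⟩).1 hm) ?_)
    rw [(haug ⟨c, hc⟩ 0).1 (by simpa using hy), map_zero]
  · intro n i z hz
    obtain ⟨h, hw, hh, hv⟩ := h_surj n i (toHomology n i ⟨z, hz⟩)
    obtain ⟨c, rfl⟩ := P.tensorClass_surjective A n i h
    -- The class has weight `i` but the chosen cycle need not; its part of weight `i` represents the
    -- same class.
    have hpc := proj_mem_cycles (P.tensorWeight W) i c.2
    have hcl := (tensorClass_proj W i c).trans hw
    refine ⟨_, hpc, (P.tensorWeight W).proj_self _ _ _ _, (hfix ⟨_, hpc⟩).2 ?_,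
      (haug ⟨_, hpc⟩ ⟨z, hz⟩).2 ?_⟩
    · rw [hcl]; exact hh
    · rw [hcl]; exact hv

end DGOperad

open Polynomial

/-! ### Endomorphisms and their polynomials -/

lemma aeval_intertwine {k M N : Type*} [Field k] [AddCommGroup M] [Module k M] [AddCommGroup N]
    [Module k N] {S : Module.End k M} {T : Module.End k N} (μ : M →ₗ[k] N)
    (h : ∀ x, T (μ x) = μ (S x)) (r : k[X]) (x : M) : aeval T r (μ x) = μ (aeval S r x) := by
  induction r using Polynomial.induction_on' with
  | add p q hp hq => simp [hp, hq]
  | monomial n a =>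
    have : ∀ x, (T ^ n) (μ x) = μ ((S ^ n) x) := by
      induction n with
      | zero => simp
      | succ n ih => intro x; rw [pow_succ, pow_succ, Module.End.mul_apply, h, ih]; rfl
    simp [aeval_monomial, this, Algebra.algebraMap_eq_smul_one]

/-- A vector killed by a monic polynomial in `T` lies in a finite dimensional invariant subspace. -/
lemma exists_finite_invariant {k M : Type*} [Field k] [AddCommGroup M] [Module k M]
    (T : Module.End k M) {p : k[X]} (hp : p.Monic) {c : M} (hc : aeval T p c = 0) :
    ∃ N : Submodule k M, Module.Finite k N ∧ c ∈ N ∧ (∀ x ∈ N, T x ∈ N) ∧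
      ∀ x ∈ N, aeval T p x = 0 := by
  -- The invariant subspace is `k[T] c`; reduction modulo `p` shows that it is spanned by
  -- polynomials of degree less than that of `p`.
  let g : k[X] →ₗ[k] M := (LinearMap.applyₗ c) ∘ₗ (aeval T).toLinearMap
  have hg : ∀ r, g r = aeval T r c := fun _ => rfl
  have hmod : ∀ r, g (r %ₘ p) = g r := by
    intro r
    conv_rhs => rw [← modByMonic_add_div r p]
    rw [map_add, hg (p * _), mul_comm, map_mul, Module.End.mul_apply, hc, map_zero, add_zero]
  have hmem : ∀ r, g r ∈ (degreeLT k p.natDegree).map g := fun r => by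
    refine ⟨r %ₘ p, ?_, hmod r⟩
    rw [SetLike.mem_coe, mem_degreeLT, ← degree_eq_natDegree hp.ne_zero]
    exact degree_modByMonic_lt r hp
  have : Module.Finite k (degreeLT k p.natDegree) :=
    Module.Finite.equiv (degreeLTEquiv k p.natDegree).symm
  refine ⟨(degreeLT k p.natDegree).map g, inferInstance, ?_, ?_, ?_⟩
  · have := hmem 1
    rwa [hg, map_one] at this
  · rintro _ ⟨r, _, rfl⟩
    have := hmem (X * r)
    rwa [hg, map_mul, aeval_X] at this
  · rintro _ ⟨r, _, rfl⟩
    rw [hg, ← Module.End.mul_apply, ← map_mul, mul_comm, map_mul, Module.End.mul_apply, hc,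
      map_zero]

/-- Commuting endomorphisms `a` and `t`: `r(t) - r(a)` is divisible by `t - a`. -/
lemma exists_aeval_sub {k A : Type*} [Field k] [Ring A] [Algebra k A] {a t : A} (h : Commute a t)
    (r : k[X]) : ∃ s, aeval t r - aeval a r = (t - a) * s ∧ Commute (t - a) s := by
  have ht : Commute (t - a) t := (Commute.refl t).sub_left h
  have ha : Commute (t - a) a := h.symm.sub_left (Commute.refl a)
  induction r using Polynomial.induction_on' with
  | add p q hp hq =>
    obtain ⟨s, hs, hs'⟩ := hp
    obtain ⟨s₂, hs₂, hs₂'⟩ := hq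
    refine ⟨s + s₂, ?_, hs'.add_right hs₂'⟩
    rw [map_add, map_add, mul_add, ← hs, ← hs₂]
    abel
  | monomial n c =>
    induction n with
    | zero => exact ⟨0, by simp, Commute.zero_right _⟩
    | succ n ih =>
      obtain ⟨s, hs, hs'⟩ := ih
      have hm : Commute (t - a) (aeval a (monomial n c)) := by
        rw [aeval_monomial]
        exact (Algebra.commute_algebraMap_right _ _).mul_right (ha.pow_right n)
      refine ⟨s * t + aeval a (monomial n c), ?_, (hs'.mul_right ht).add_right hm⟩
      rw [← monomial_mul_X, map_mul, map_mul, aeval_X, aeval_X, mul_add, ← mul_assoc, ← hs,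
        hm.eq, mul_sub, sub_mul]
      abel

/-! ### Weights of roots and pure polynomials -/

namespace WeightFunction

variable {k : Type u} [Field k] (w : WeightFunction k)

lemma IsPureElement.mul {w : WeightFunction k} {i j : ℤ} {x y : AlgebraicClosure k}
    (hx : w.IsPureElement i x) (hy : w.IsPureElement j y) : w.IsPureElement (i + j) (x * y) := by
  obtain ⟨γ, rfl, rfl⟩ := hx
  obtain ⟨δ, rfl, rfl⟩ := hy
  exact ⟨γ * δ, by simp, by rw [map_mul, toAdd_mul]⟩

lemma IsPureElement.eq {w : WeightFunction k} {i j : ℤ} {x : AlgebraicClosure k}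
    (hx : w.IsPureElement i x) (hy : w.IsPureElement j x) : i = j := by
  obtain ⟨γ, hγ, rfl⟩ := hx
  obtain ⟨δ, hδ, rfl⟩ := hy
  have : γ = δ := Subtype.ext (Units.ext (hγ.trans hδ.symm))
  rw [this]

lemma IsPureElement.ne_zero {w : WeightFunction k} {i : ℤ} {x : AlgebraicClosure k}
    (hx : w.IsPureElement i x) : x ≠ 0 := by
  obtain ⟨γ, rfl, _⟩ := hx
  exact Units.ne_zero _

lemma isPurePolynomial_one (i : ℤ) : w.IsPurePolynomial i 1 := fun x hx => by simp at hx

lemma IsPurePolynomial.mul {w : WeightFunction k} {i : ℤ} {p q : k[X]} (hp : p.Monic)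
    (hq : q.Monic) (hpi : w.IsPurePolynomial i p) (hqi : w.IsPurePolynomial i q) :
    w.IsPurePolynomial i (p * q) := by
  intro x hx
  rw [aroots_mul (mul_ne_zero hp.ne_zero hq.ne_zero), Multiset.mem_add] at hx
  exact hx.elim (hpi x) (hqi x)

/-- A common root in the algebraic closure would have two different weights. -/
lemma IsPurePolynomial.isCoprime {w : WeightFunction k} {i j : ℤ} (hij : i ≠ j) {p q : k[X]}
    (hp : p.Monic) (hq : q.Monic) (hpi : w.IsPurePolynomial i p) (hqj : w.IsPurePolynomial j q) :
    IsCoprime p q := by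
  rw [Polynomial.isCoprime_iff_aeval_ne_zero_of_isAlgClosed k (AlgebraicClosure k)]
  intro x
  by_contra! h
  exact hij ((hpi x (mem_aroots.2 ⟨hp.ne_zero, h.1⟩)).eq (hqj x (mem_aroots.2 ⟨hq.ne_zero, h.2⟩)))

/-- The product of commuting endomorphisms killed by polynomials of weights `i` and `j` is pure of
weight `i + j`. -/
lemma isPurePolynomial_charpoly_mul {w : WeightFunction k} {i j : ℤ} {p q : k[X]} (hp : p.Monic)
    (hq : q.Monic) (hpi : w.IsPurePolynomial i p) (hqj : w.IsPurePolynomial j q) {U : Type*}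
    [AddCommGroup U] [Module k U] [Module.Finite k U] (X Y : Module.End k U) (hXY : Commute X Y)
    (hX : aeval X p = 0) (hY : aeval Y q = 0) :
    w.IsPurePolynomial (i + j) (LinearMap.charpoly (X * Y)) := by
  intro x hx
  let K := AlgebraicClosure k
  let B := Module.End.baseChangeHom k K U
  have hx' : ((X * Y).baseChange K).charpoly.IsRoot x := by
    rw [LinearMap.charpoly_baseChange]
    exact isRoot_of_mem_roots hx
  rw [← Module.End.hasEigenvalue_iff_isRoot_charpoly] at hx'
  have hB : (X * Y).baseChange K = B X * B Y := map_mul B X Y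
  rw [hB] at hx'
  have hc : Commute (B X) (B Y) := hXY.map B
  have hroot : ∀ (Z : Module.End k U) (r : k[X]) (α : K) (v : K ⊗[k] U), aeval Z r = 0 → v ≠ 0 →
      B Z v = α • v → aeval α r = 0 := by
    intro Z r α v hZ hv hZv
    have h1 : aeval (B Z) r = 0 := by rw [aeval_algHom_apply, hZ, map_zero]
    have h2 := Module.End.aeval_apply_of_hasEigenvector (p := r.map (algebraMap k K))
      (f := B Z) (μ := α) (x := v) ⟨Module.End.mem_eigenspace_iff.2 hZv, hv⟩
    rw [aeval_map_algebraMap, h1, eval_map_algebraMap] at h2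
    exact (smul_eq_zero.1 h2.symm).resolve_right hv
  -- `X` preserves each eigenspace of `X * Y`, so over the algebraic closure it has an eigenvector
  -- there. Dividing `x` by that eigenvalue gives an eigenvalue of `Y`, and weights add.
  let E := Module.End.eigenspace (B X * B Y) x
  have : Nontrivial E := Submodule.nontrivial_iff_ne_bot.2 hx'
  have hEX : ∀ v ∈ E, B X v ∈ E := by
    intro v hv
    rw [Module.End.mem_eigenspace_iff] at hv ⊢
    have : (B X * B Y) (B X v) = B X ((B X * B Y) v) := by
      rw [← Module.End.mul_apply, ← Module.End.mul_apply, mul_assoc, ← hc.eq]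
    rw [this, hv, map_smul]
  obtain ⟨α, hα⟩ := Module.End.exists_eigenvalue (K := K) (V := E) ((B X).restrict hEX)
  obtain ⟨⟨v, hvE⟩, hv⟩ := hα.exists_hasEigenvector
  have hXv : B X v = α • v := congrArg Subtype.val hv.apply_eq_smul
  have hv0 : v ≠ 0 := fun h => hv.2 (Subtype.ext h)
  have hα0 := hpi α (mem_aroots.2 ⟨hp.ne_zero, hroot X p α v hX hv0 hXv⟩)
  have hYv : B Y v = (α⁻¹ * x) • v := by
    rw [Module.End.mem_eigenspace_iff, hc.eq, Module.End.mul_apply, hXv, map_smul] at hvE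
    rw [mul_smul, ← hvE, smul_smul, inv_mul_cancel₀ hα0.ne_zero, one_smul]
  have := hα0.mul (hqj _ (mem_aroots.2 ⟨hq.ne_zero, hroot Y q _ v hY hv0 hYv⟩))
  rwa [mul_inv_cancel_left₀ hα0.ne_zero] at this

/-- `S ⊗ T` is the product of the commuting endomorphisms `S ⊗ 1` and `1 ⊗ T`. -/
lemma isPurePolynomial_charpoly_map {w : WeightFunction k} {i j : ℤ} {p q : k[X]} (hp : p.Monic)
    (hq : q.Monic) (hpi : w.IsPurePolynomial i p) (hqj : w.IsPurePolynomial j q) {U V : Type*}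
    [AddCommGroup U] [Module k U] [Module.Finite k U] [AddCommGroup V] [Module k V]
    [Module.Finite k V] (S : Module.End k U) (T : Module.End k V)
    (hS : aeval S p = 0) (hT : aeval T q = 0) :
    w.IsPurePolynomial (i + j) (LinearMap.charpoly (TensorProduct.map S T)) := by
  have h := isPurePolynomial_charpoly_mul hp hq hpi hqj (Module.End.rTensorAlgHom k U V S)
    (Module.End.lTensorAlgHom k V U T)
    ((LinearMap.rTensor_comp_lTensor _ S T).trans (LinearMap.lTensor_comp_rTensor _ S T).symm)
    (by rw [aeval_algHom_apply, hS, map_zero]) (by rw [aeval_algHom_apply, hT, map_zero])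
  have e : Module.End.rTensorAlgHom k U V S * Module.End.lTensorAlgHom k V U T =
    TensorProduct.map S T := LinearMap.rTensor_comp_lTensor _ S T
  rwa [e] at h

/-! ### Pure recurrent sequences -/

/-- The translation by `m` of sequences indexed by `ℤ`. -/
def translate (k : Type u) [Field k] (m : ℤ) : (ℤ → k) →ₐ[k] (ℤ → k) :=
  AlgHom.pi fun n => Pi.evalAlgHom k (fun _ : ℤ => k) (n + m)

@[simp] lemma translate_apply (m : ℤ) (c : ℤ → k) (n : ℤ) : translate k m c n = c (n + m) := rfl

/-- The shift of sequences indexed by `ℤ`. -/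
abbrev shift (k : Type u) [Field k] : Module.End k (ℤ → k) := (translate k 1).toLinearMap

/-- The sequences that satisfy a linear recurrence with characteristic polynomial pure of
weight `j`. -/
def recurrent (j : ℤ) : Submodule k (ℤ → k) where
  carrier := {c | ∃ p : k[X], p.Monic ∧ w.IsPurePolynomial j p ∧ aeval (shift k) p c = 0}
  zero_mem' := ⟨1, monic_one, w.isPurePolynomial_one j, map_zero _⟩
  add_mem' := by
    rintro c b ⟨p, hp, hpj, hc⟩ ⟨q, hq, hqj, hb⟩
    -- The product of the two polynomials kills both sequences and is still pure of weight `j`.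
    refine ⟨p * q, hp.mul hq, hpj.mul hp hq hqj, ?_⟩
    rw [map_add]
    nth_rw 1 [mul_comm p q]
    rw [map_mul, map_mul, Module.End.mul_apply, Module.End.mul_apply, hc, hb, map_zero, map_zero,
      add_zero]
  smul_mem' := by
    rintro a c ⟨p, hp, hpj, hc⟩
    exact ⟨p, hp, hpj, by rw [map_smul, hc, smul_zero]⟩

variable {w}

lemma translate_mem_recurrent (m : ℤ) {j : ℤ} {c : ℤ → k} (hc : c ∈ w.recurrent j) :
    translate k m c ∈ w.recurrent j := by
  obtain ⟨p, hp, hpj, hc⟩ := hc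
  refine ⟨p, hp, hpj, ?_⟩
  have := aeval_intertwine (S := shift k) (T := shift k) (translate k m).toLinearMap
    (fun x => funext fun n => by simp; congr 1; ring) p c
  refine this.trans ?_
  rw [hc, map_zero]

lemma one_mem_recurrent : (1 : ℤ → k) ∈ w.recurrent 0 := by
  refine ⟨X - C 1, monic_X_sub_C 1, ?_, ?_⟩
  · intro x hx
    rw [mem_aroots] at hx
    have hx : x = 1 := by simpa [sub_eq_zero] using hx.2
    exact ⟨1, by simp [hx], by simp⟩
  · ext n
    simp

/-- The two sequences lie in finite dimensional shift-invariant spaces `N` and `N'`. The shift is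
multiplicative, so the product map from `N ⊗ N'` intertwines `S ⊗ S'` with the shift. By
Cayley–Hamilton the characteristic polynomial of `S ⊗ S'`, which is pure of weight `i + j`, then
kills the product. -/
lemma mul_mem_recurrent {i j : ℤ} {c b : ℤ → k} (hc : c ∈ w.recurrent i)
    (hb : b ∈ w.recurrent j) : c * b ∈ w.recurrent (i + j) := by
  obtain ⟨p, hp, hpi, hc⟩ := hc
  obtain ⟨q, hq, hqj, hb⟩ := hb
  obtain ⟨N, _, hcN, hN, hNp⟩ := exists_finite_invariant _ hp hc
  obtain ⟨N', _, hbN, hN', hNq⟩ := exists_finite_invariant _ hq hb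
  let S : Module.End k N := (shift k).restrict hN
  let S' : Module.End k N' := (shift k).restrict hN'
  have hS : aeval S p = 0 := by
    ext1 x
    apply Subtype.ext
    exact (aeval_intertwine (S := S) (T := shift k) N.subtype (fun _ => rfl) p x).symm.trans
      (hNp x x.2)
  have hS' : aeval S' q = 0 := by
    ext1 x
    apply Subtype.ext
    exact (aeval_intertwine (S := S') (T := shift k) N'.subtype (fun _ => rfl) q x).symm.trans
      (hNq x x.2)
  let μ : N ⊗[k] N' →ₗ[k] (ℤ → k) :=
    TensorProduct.lift ((LinearMap.mul k (ℤ → k)).domRestrict₁₂ N N')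
  refine ⟨_, LinearMap.charpoly_monic _,
    isPurePolynomial_charpoly_map hp hq hpi hqj S S' hS hS', ?_⟩
  have := aeval_intertwine (T := shift k) (S := TensorProduct.map S S') μ
    (fun x => by
      induction x using TensorProduct.induction_on with
      | zero => simp
      | add x y hx hy => simp only [map_add, hx, hy]
      | tmul x y => rfl) (LinearMap.charpoly (M := N ⊗[k] N') (TensorProduct.map S S'))
      ((⟨c, hcN⟩ : N) ⊗ₜ (⟨b, hbN⟩ : N'))
  refine this.trans ((congrArg μ ?_).trans (map_zero μ))
  exact congrArg (fun g : N ⊗[k] N' →ₗ[k] N ⊗[k] N' => g _)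
    (LinearMap.aeval_self_charpoly (M := N ⊗[k] N') (TensorProduct.map S S'))

end WeightFunction

/-! ### The weight graded algebra of pure recurrent sequences -/

namespace WeightFunction

variable {k : Type u} [Field k] (w : WeightFunction k)

instance : SetLike.GradedMonoid w.recurrent where
  one_mem := one_mem_recurrent
  mul_mem _ _ _ _ := mul_mem_recurrent

/-- The weight graded algebra of pure recurrent sequences. -/
abbrev RecAlg : Type u := DirectSum ℤ fun j => w.recurrent j

/-- The translation by `m` of pure recurrent sequences. -/
def translateRec (m j : ℤ) : w.recurrent j →ₗ[k] w.recurrent j :=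
  (translate k m).toLinearMap.restrict fun _ => translate_mem_recurrent m

/-- The backward shift, as an algebra endomorphism. -/
noncomputable def backShift : w.RecAlg →ₐ[k] w.RecAlg :=
  DirectSum.toAlgebra k _ (fun j => DirectSum.lof k ℤ (fun j => w.recurrent j) j ∘ₗ
    w.translateRec (-1) j) (by
      rw [LinearMap.comp_apply, DirectSum.lof_eq_of]
      rfl)
    (by
      intro i j a b
      simp only [LinearMap.comp_apply, DirectSum.lof_eq_of, DirectSum.of_mul_of]
      rfl)

lemma backShift_lof (j : ℤ) (c : w.recurrent j) :
    w.backShift (DirectSum.lof k ℤ (fun j => w.recurrent j) j c) =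
      DirectSum.lof k ℤ (fun j => w.recurrent j) j (w.translateRec (-1) j c) :=
  DirectSum.toAddMonoid_of (fun j => (DirectSum.lof k ℤ (fun j => w.recurrent j) j ∘ₗ
    w.translateRec (-1) j).toAddMonoidHom) j c

/-- The term of index zero, as an augmentation. -/
noncomputable def evalZero : w.RecAlg →ₐ[k] k :=
  DirectSum.toAlgebra k _ (fun j => LinearMap.proj 0 ∘ₗ (w.recurrent j).subtype) rfl
    (fun _ _ => rfl)

lemma evalZero_lof (j : ℤ) (c : w.recurrent j) :
    w.evalZero (DirectSum.lof k ℤ (fun j => w.recurrent j) j c) = c.1 0 :=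
  DirectSum.toAddMonoid_of
    (fun j => (LinearMap.proj 0 ∘ₗ (w.recurrent j).subtype).toAddMonoidHom) j c

/-- The weight grading of the algebra of pure recurrent sequences. -/
noncomputable def recWeight : AlgWeight k w.RecAlg where
  proj j := DirectSum.lof k ℤ (fun j => w.recurrent j) j ∘ₗ
    DirectSum.component k ℤ (fun j => w.recurrent j) j
  proj_self j x := by simp [DirectSum.component.lof_self]
  proj_ne j j' x h := by
    simp only [LinearMap.comp_apply]
    rw [DirectSum.component.of, dif_neg h.symm, map_zero]
  proj_mul v u x y := by
    simp only [LinearMap.comp_apply, DirectSum.lof_eq_of, DirectSum.of_mul_of]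
    exact congrArg _ (DirectSum.component.lof_self k (M := fun j => w.recurrent j) (v + u) _)
  exists_sum x := by
    classical
    refine ⟨DFinsupp.support x, fun t ht => ?_⟩
    conv_lhs => rw [← DirectSum.sum_support_of x]
    refine Finset.sum_subset ht fun j _ hj => ?_
    rw [DFinsupp.notMem_support_iff.1 hj, map_zero]

lemma recWeight_proj (j : ℤ) (x : w.RecAlg) : w.recWeight.proj j x =
    DirectSum.lof k ℤ (fun j => w.recurrent j) j
      (DirectSum.component k ℤ (fun j => w.recurrent j) j x) := rfl

lemma recWeight_backShift (j : ℤ) (x : w.RecAlg) :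
    w.recWeight.proj j (w.backShift x) = w.backShift (w.recWeight.proj j x) := by
  induction x using DirectSum.induction_on with
  | zero => simp
  | add x y hx hy => simp only [map_add, hx, hy]
  | of i c =>
    rw [← DirectSum.lof_eq_of k, backShift_lof, recWeight_proj, recWeight_proj]
    by_cases h : i = j
    · subst h
      rw [DirectSum.component.lof_self, DirectSum.component.lof_self, backShift_lof]
    · rw [DirectSum.component.of, DirectSum.component.of, dif_neg h, dif_neg h, map_zero, map_zero]

/-! ### Fixed vectors in `V ⊗ A` for the algebra `A` of pure recurrent sequences -/

section Fixed

variable {w} {V : Type u} [AddCommGroup V] [Module k V] {i j : ℤ}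

/-- The inclusion of the part of weight `j`. -/
noncomputable def tensorLof (w : WeightFunction k) (V : Type u) [AddCommGroup V] [Module k V]
    (j : ℤ) : V ⊗[k] w.recurrent j →ₗ[k] V ⊗[k] w.RecAlg :=
  (DirectSum.lof k ℤ (fun j => w.recurrent j) j).lTensor V

lemma exists_tensorLof {h : V ⊗[k] w.RecAlg} (hh : (w.recWeight.proj j).lTensor V h = h) :
    ∃ h', tensorLof w V j h' = h :=
  ⟨(DirectSum.component k ℤ (fun j => w.recurrent j) j).lTensor V h, by
    rw [tensorLof, ← LinearMap.comp_apply, ← LinearMap.lTensor_comp]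
    exact hh⟩

lemma proj_tensorLof (h : V ⊗[k] w.recurrent j) :
    (w.recWeight.proj j).lTensor V (tensorLof w V j h) = tensorLof w V j h := by
  rw [tensorLof, ← LinearMap.comp_apply, ← LinearMap.lTensor_comp]
  congr 2
  ext1 x
  rw [LinearMap.comp_apply, recWeight_proj, DirectSum.component.lof_self]

lemma tensorLof_injective : Function.Injective (tensorLof w V j) := by
  refine Function.LeftInverse.injective
    (g := (DirectSum.component k ℤ (fun j => w.recurrent j) j).lTensor V) fun h => ?_
  rw [tensorLof, ← LinearMap.comp_apply, ← LinearMap.lTensor_comp]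
  have : DirectSum.component k ℤ (fun j => w.recurrent j) j ∘ₗ
      DirectSum.lof k ℤ (fun j => w.recurrent j) j = LinearMap.id :=
    LinearMap.ext fun x => DirectSum.component.lof_self k (M := fun j => w.recurrent j) j x
  rw [this, LinearMap.lTensor_id, LinearMap.id_apply]

lemma map_tensorLof (φ : V →ₗ[k] V) (h : V ⊗[k] w.recurrent j) :
    TensorProduct.map φ w.backShift.toLinearMap (tensorLof w V j h) =
      tensorLof w V j (TensorProduct.map φ (w.translateRec (-1) j) h) := by
  induction h using TensorProduct.induction_on with
  | zero => simp
  | add x y hx hy => simp only [map_add, hx, hy]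
  | tmul v c =>
    simp only [tensorLof, LinearMap.lTensor_tmul, TensorProduct.map_tmul, AlgHom.toLinearMap_apply,
      backShift_lof]

/-- The term of index `n` of a sequence with values in `V`. -/
noncomputable def term (w : WeightFunction k) (V : Type u) [AddCommGroup V] [Module k V]
    (j n : ℤ) : V ⊗[k] w.recurrent j →ₗ[k] V :=
  (TensorProduct.rid k V).toLinearMap ∘ₗ
    (LinearMap.proj n ∘ₗ (w.recurrent j).subtype).lTensor V

lemma term_tmul (n : ℤ) (v : V) (c : w.recurrent j) : term w V j n (v ⊗ₜ c) = c.1 n • v := by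
  simp [term]

lemma augMap_tensorLof (h : V ⊗[k] w.recurrent j) :
    DGOperad.augMap (A := w.RecAlg) V w.evalZero (tensorLof w V j h) = term w V j 0 h := by
  induction h using TensorProduct.induction_on with
  | zero => simp
  | add x y hx hy => simp only [map_add, hx, hy]
  | tmul v c =>
    rw [tensorLof, LinearMap.lTensor_tmul, DGOperad.augMap_tmul, evalZero_lof, term_tmul]

/-- This is why the shift goes backward: a fixed vector satisfies `h(n) = φ (h(n - 1))`, hence is
the orbit of `h(0)` under `φ`. -/
lemma term_map (φ : V →ₗ[k] V) (n : ℤ) (h : V ⊗[k] w.recurrent j) :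
    term w V j n (TensorProduct.map φ (w.translateRec (-1) j) h) = φ (term w V j (n - 1) h) := by
  induction h using TensorProduct.induction_on with
  | zero => simp
  | add x y hx hy => simp only [map_add, hx, hy]
  | tmul v c =>
    rw [TensorProduct.map_tmul, term_tmul, term_tmul, map_smul]
    rfl

/-- In a basis of `V` the coordinates of `h` are scalar sequences, so `h` may be treated as a
sequence of vectors. -/
lemma eq_of_term_eq [Module.Finite k V] {h h' : V ⊗[k] w.recurrent j}
    (hh : ∀ n, term w V j n h = term w V j n h') : h = h' := by
  let b := Module.finBasis k V
  apply (TensorProduct.equivFinsuppOfBasisLeft b).injective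
  have key : ∀ (x : V ⊗[k] w.recurrent j) a n,
      (TensorProduct.equivFinsuppOfBasisLeft b x a).1 n = b.repr (term w V j n x) a := by
    intro x a n
    induction x using TensorProduct.induction_on with
    | zero => simp
    | add x y hx hy => simp [hx, hy]
    | tmul v c =>
      rw [TensorProduct.equivFinsuppOfBasisLeft_apply_tmul_apply, term_tmul]
      simp [mul_comm]
  ext a n
  rw [key, key, hh]

variable [Module.Finite k V] {φ : V →ₗ[k] V}

/-- Only units have weights, so `0` is not an eigenvalue. -/
lemma injective_of_isPure (hφ : w.IsPurePolynomial i φ.charpoly) : Function.Injective φ := by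
  rw [← LinearMap.ker_eq_bot]
  by_contra h
  have h0 : Module.End.HasEigenvalue φ 0 := by
    rwa [Module.End.hasEigenvalue_iff, Module.End.eigenspace_zero]
  rw [Module.End.hasEigenvalue_iff_isRoot_charpoly] at h0
  refine (hφ 0 (mem_aroots.2 ⟨(LinearMap.charpoly_monic φ).ne_zero, ?_⟩)).ne_zero rfl
  rw [← map_zero (algebraMap k (AlgebraicClosure k)), aeval_algebraMap_apply, coe_aeval_eq_eval,
    h0.eq_zero, map_zero]

/-- In weights different from that of `φ`, the endomorphism `1 - φ ⊗ θ` is bijective. -/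
lemma bijective_sub_map (hij : j ≠ i) (hφ : w.IsPurePolynomial i φ.charpoly) :
    Function.Bijective fun h : V ⊗[k] w.recurrent j =>
      h - TensorProduct.map φ (w.translateRec (-1) j) h := by
  let t : Module.End k (V ⊗[k] w.recurrent j) :=
    Module.End.lTensorAlgHom k (w.recurrent j) V (w.translateRec 1 j)
  let t' : Module.End k (V ⊗[k] w.recurrent j) :=
    Module.End.lTensorAlgHom k (w.recurrent j) V (w.translateRec (-1) j)
  let a : Module.End k (V ⊗[k] w.recurrent j) :=
    Module.End.rTensorAlgHom k V (w.recurrent j) φ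
  have htr : (w.translateRec 1 j * w.translateRec (-1) j : Module.End k (w.recurrent j)) = 1 := by
    ext c n
    change c.1 (n + 1 + -1) = c.1 n
    rw [add_neg_cancel_right]
  have htr' : (w.translateRec (-1) j * w.translateRec 1 j : Module.End k (w.recurrent j)) = 1 := by
    ext c n
    change c.1 (n + -1 + 1) = c.1 n
    rw [neg_add_cancel_right]
  have htt' : t * t' = 1 := by rw [← map_mul, htr, map_one]
  have ht't : t' * t = 1 := by rw [← map_mul, htr', map_one]
  have hat : Commute a t :=
    (LinearMap.rTensor_comp_lTensor _ φ _).trans (LinearMap.lTensor_comp_rTensor _ φ _).symm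
  have hmap : TensorProduct.map φ (w.translateRec (-1) j) = a * t' :=
    (LinearMap.rTensor_comp_lTensor _ φ _).symm
  -- As `φ.charpoly` vanishes at `a`, its value at `t` is a multiple of `t - a`. It is enough to
  -- invert that value.
  obtain ⟨s, hs, hs'⟩ := exists_aeval_sub hat φ.charpoly
  have ha : aeval a φ.charpoly = 0 := by
    rw [aeval_algHom_apply, LinearMap.aeval_self_charpoly, map_zero]
  rw [ha, sub_zero] at hs
  -- Each `h` is killed by some `p(t)` with `p` pure of weight `j`, hence coprime to `φ.charpoly`; a
  -- Bézout relation gives the inverse. The polynomial `p`, and so `r`, depends on `h`.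
  have hbij : ∀ h : V ⊗[k] w.recurrent j, ∃ r : Module.End k (V ⊗[k] w.recurrent j),
      aeval t φ.charpoly (r h) = h ∧ r (aeval t φ.charpoly h) = h := by
    intro h
    have : ∃ p : k[X], p.Monic ∧ w.IsPurePolynomial j p ∧ aeval t p h = 0 := by
      induction h using TensorProduct.induction_on with
      | zero => exact ⟨1, monic_one, w.isPurePolynomial_one j, map_zero _⟩
      | add x y hx hy =>
        obtain ⟨p, hp, hpj, hx⟩ := hx
        obtain ⟨q, hq, hqj, hy⟩ := hy
        refine ⟨p * q, hp.mul hq, hpj.mul hp hq hqj, ?_⟩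
        rw [map_add]
        nth_rw 1 [mul_comm p q]
        rw [map_mul, map_mul, Module.End.mul_apply, Module.End.mul_apply, hx, hy, map_zero,
          map_zero, add_zero]
      | tmul v c =>
        obtain ⟨p, hp, hpj, hc⟩ := c.2
        refine ⟨p, hp, hpj, ?_⟩
        have : aeval (w.translateRec 1 j : Module.End k _) p c = 0 := by
          apply Subtype.ext
          exact (aeval_intertwine (S := w.translateRec 1 j) (T := shift k)
            (w.recurrent j).subtype (fun _ => rfl) p c).symm.trans hc
        rw [aeval_algHom_apply]
        change v ⊗ₜ[k] (aeval (w.translateRec 1 j : Module.End k _) p c) = 0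
        rw [this, TensorProduct.tmul_zero]
    obtain ⟨p, hp, hpj, hph⟩ := this
    obtain ⟨u, v, huv⟩ := hpj.isCoprime hij hp (LinearMap.charpoly_monic φ) hφ
    have h1 := congrArg (fun q => aeval t q h) huv
    simp only [map_add, map_mul, map_one, LinearMap.add_apply, Module.End.mul_apply, hph,
      map_zero, zero_add, Module.End.one_apply] at h1
    refine ⟨aeval t v, ?_, h1⟩
    rw [← Module.End.mul_apply, ← map_mul, mul_comm, map_mul, Module.End.mul_apply, h1]
  have hinj : ∀ h, (t - a) h = 0 → h = 0 := by
    intro h hh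
    obtain ⟨r, _, hr⟩ := hbij h
    rw [← hr, hs, hs'.eq, Module.End.mul_apply, hh, map_zero, map_zero]
  have hsurj : ∀ h, ∃ y, (t - a) y = h := by
    intro h
    obtain ⟨r, hr, _⟩ := hbij h
    exact ⟨s (r h), by rw [← Module.End.mul_apply, ← hs, hr]⟩
  have htt'a : ∀ h, t (t' h) = h := fun h => by rw [← Module.End.mul_apply, htt']; rfl
  have ht'ta : ∀ h, t' (t h) = h := fun h => by rw [← Module.End.mul_apply, ht't]; rfl
  -- Here `1 - a t' = (t - a) t'`, where `t'` is inverse to `t`.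
  rw [hmap]
  constructor
  · intro x y hxy
    simp only [Module.End.mul_apply] at hxy
    rw [← sub_eq_zero]
    have := hinj (t' (x - y)) (by
      rw [LinearMap.sub_apply, htt'a, map_sub, map_sub, ← sub_eq_zero.2 hxy]
      abel)
    rw [← htt'a (x - y), this, map_zero]
  · intro h
    obtain ⟨y, hy⟩ := hsurj h
    exact ⟨t y, by simp only [Module.End.mul_apply, ht'ta]; exact hy⟩

/-- In the weight of `φ`, a fixed vector is determined by its term of index zero. -/
lemma eq_zero_of_fixed (hφ : w.IsPurePolynomial i φ.charpoly) {h : V ⊗[k] w.recurrent j}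
    (hh : h = TensorProduct.map φ (w.translateRec (-1) j) h) (h0 : term w V j 0 h = 0) :
    h = 0 := by
  have hstep : ∀ n, term w V j n h = φ (term w V j (n - 1) h) := fun n => by
    conv_lhs => rw [hh, term_map]
  refine eq_of_term_eq fun n => ?_
  rw [map_zero]
  induction n using Int.induction_on with
  | zero => exact h0
  | succ n ih => rw [hstep, add_sub_cancel_right, ih, map_zero]
  -- Going to negative indices uses that `φ` is injective.
  | pred n ih =>
    rw [hstep] at ih
    exact injective_of_isPure hφ (ih.trans (map_zero φ).symm)

/-- In the weight of `φ`, each vector is the term of index zero of a fixed vector. -/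
lemma exists_fixed (hφ : w.IsPurePolynomial i φ.charpoly) (v : V) :
    ∃ h : V ⊗[k] w.recurrent i, h = TensorProduct.map φ (w.translateRec (-1) i) h ∧
      term w V i 0 h = v := by
  let e : V ≃ₗ[k] V := LinearEquiv.ofInjectiveEndo φ (injective_of_isPure hφ)
  have he : ∀ x, e x = φ x := fun _ => rfl
  have hpow : ∀ (n : ℤ) (x : V), (e ^ n) (φ x) = (e ^ (n + 1)) x := by
    intro n x
    rw [zpow_add_one, LinearEquiv.mul_apply, he]
  have hpow' : ∀ (n : ℤ) (x : V), φ ((e ^ (n - 1)) x) = (e ^ n) x := by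
    intro n x
    rw [← he, ← LinearEquiv.mul_apply, ← zpow_one_add, add_sub_cancel]
  let b := Module.finBasis k V
  -- The fixed vector is the orbit `n ↦ φ^n v`. Its coordinates satisfy the recurrence given by
  -- `φ.charpoly`, which is pure of weight `i`: this is where the weight of the fixed vectors comes
  -- from.
  let μ : ∀ _ : Fin (Module.finrank k V), V →ₗ[k] (ℤ → k) := fun a =>
    LinearMap.pi fun n => b.coord a ∘ₗ (e ^ n).toLinearMap
  have hμ : ∀ a, μ a v ∈ w.recurrent i := by
    intro a
    refine ⟨φ.charpoly, LinearMap.charpoly_monic φ, hφ, ?_⟩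
    rw [aeval_intertwine (S := φ) (T := shift k) (μ a) (fun x => funext fun n =>
      (congrArg (b.coord a) (hpow n x)).symm), LinearMap.aeval_self_charpoly,
      LinearMap.zero_apply, map_zero]
  let h : V ⊗[k] w.recurrent i := ∑ a, b a ⊗ₜ ⟨μ a v, hμ a⟩
  have hterm : ∀ n, term w V i n h = (e ^ n) v := by
    intro n
    rw [map_sum]
    simp only [term_tmul]
    exact b.sum_repr ((e ^ n) v)
  refine ⟨h, eq_of_term_eq fun n => ?_, ?_⟩
  · rw [term_map, hterm, hterm, hpow']
  · rw [hterm, zpow_zero]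
    rfl

end Fixed

/-! ### Formality from a pure endomorphism -/

/-- A dg operad with a pure endomorphism is formal. -/
theorem isFormal_of_isPureEndo [CharZero k] {P : DGOperad k} (f : P ⟶ P) (hf : w.IsPureEndo 0 f) :
    P.IsFormal := by
  refine DGOperad.isFormal_of_endo f w.recWeight w.backShift w.recWeight_backShift w.evalZero
    ?_ ?_ ?_ ?_
  · intro n i j hij h hw
    obtain ⟨_, hφ⟩ := hf n i
    rw [zero_add] at hφ
    obtain ⟨h, rfl⟩ := exists_tensorLof hw
    obtain ⟨h', rfl⟩ := (bijective_sub_map hij hφ).2 h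
    exact ⟨tensorLof w _ j h', by rw [map_tensorLof, ← map_sub]⟩
  · intro n i j hij h hw hh
    obtain ⟨_, hφ⟩ := hf n i
    rw [zero_add] at hφ
    obtain ⟨h, rfl⟩ := exists_tensorLof hw
    rw [map_tensorLof] at hh
    have : h = 0 := (bijective_sub_map hij hφ).1 (by
      simp only [map_zero, sub_zero]
      exact sub_eq_zero.2 (tensorLof_injective hh))
    rw [this, map_zero]
  · intro n i h hw hh h0
    obtain ⟨_, hφ⟩ := hf n i
    rw [zero_add] at hφ
    obtain ⟨h, rfl⟩ := exists_tensorLof hw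
    rw [map_tensorLof] at hh
    rw [augMap_tensorLof] at h0
    rw [eq_zero_of_fixed hφ (tensorLof_injective hh) h0, map_zero]
  · intro n i v
    obtain ⟨_, hφ⟩ := hf n i
    rw [zero_add] at hφ
    obtain ⟨h, hh, hv⟩ := exists_fixed hφ v
    exact ⟨tensorLof w _ i h, proj_tensorLof h, by rw [map_tensorLof, ← hh],
      by rw [augMap_tensorLof, hv]⟩

end WeightFunction

/-! ### Models and automorphisms of the homology -/

namespace DGOperad

variable {k : Type u} [Field k]

/-- A morphism of dg operads that is bijective in each arity and degree is an isomorphism. -/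
noncomputable def isoOfBijective {P Q : DGOperad k} (F : P ⟶ Q)
    (hF : ∀ n i, Function.Bijective (F.f n i)) : P ≅ Q where
  hom := F
  inv :=
    { f := fun n i => (LinearEquiv.ofBijective _ (hF n i)).symm.toLinearMap
      f_d := fun n i j x => by
        obtain ⟨x, rfl⟩ := (hF n i).surjective x
        apply (hF n j).injective
        refine ((LinearEquiv.ofBijective _ (hF n j)).apply_symm_apply _).trans ?_
        refine (F.f_d n i j x).symm.trans (congrArg (F.f n j) (congrArg _ ?_))
        exact ((LinearEquiv.ofBijective _ (hF n i)).symm_apply_apply x).symm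
      f_act := fun n σ i x => by
        obtain ⟨x, rfl⟩ := (hF n i).surjective x
        apply (hF n i).injective
        refine ((LinearEquiv.ofBijective _ (hF n i)).apply_symm_apply _).trans ?_
        refine (F.f_act n σ i x).symm.trans (congrArg (F.f n i) (congrArg _ ?_))
        exact ((LinearEquiv.ofBijective _ (hF n i)).symm_apply_apply x).symm
      f_circ := by
        intro l m n h a p q r hd x y
        obtain ⟨x, rfl⟩ := (hF _ _).surjective x
        obtain ⟨y, rfl⟩ := (hF _ _).surjective y
        apply (hF n r).injective
        refine ((LinearEquiv.ofBijective _ (hF n r)).apply_symm_apply _).trans ?_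
        refine (F.f_circ h a hd x y).symm.trans (congrArg (F.f n r) ?_)
        refine congrArg₂ (fun x y => P.circ h a hd x y) ?_ ?_
        · exact ((LinearEquiv.ofBijective _ (hF l p)).symm_apply_apply x).symm
        · exact ((LinearEquiv.ofBijective _ (hF m q)).symm_apply_apply y).symm }
  hom_inv_id := by
    ext n i x
    exact (LinearEquiv.ofBijective _ (hF n i)).symm_apply_apply x
  inv_hom_id := by
    ext n i x
    exact (LinearEquiv.ofBijective _ (hF n i)).apply_symm_apply x

lemma hom_inv_f {P Q : DGOperad k} (e : P ≅ Q) (n i) (x : P.X n i) :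
    Hom.f e.inv n i (Hom.f e.hom n i x) = x := by
  rw [← comp_f, e.hom_inv_id, id_f]

lemma inv_hom_f {P Q : DGOperad k} (e : P ≅ Q) (n i) (x : Q.X n i) :
    Hom.f e.hom n i (Hom.f e.inv n i x) = x := by
  rw [← comp_f, e.inv_hom_id, id_f]

lemma isWeakEquiv_of_iso {P Q : DGOperad k} (e : P ≅ Q) : IsWeakEquiv e.hom := fun n i =>
  Function.bijective_iff_has_inverse.2 ⟨(H.mapIso e).inv.f n i, hom_inv_f (H.mapIso e) n i,
    inv_hom_f (H.mapIso e) n i⟩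

section ZeroDifferential

variable {Q : DGOperad k}

lemma mem_cycles_of_d_eq_zero (hQ : ∀ n i j, Q.d n i j = 0) {n i} (x : Q.X n i) :
    x ∈ Q.cycles n i := by
  rw [mem_cycles, hQ, LinearMap.zero_apply]

/-- An operad with zero differential is isomorphic to its homology. -/
noncomputable def isoHomology (hQ : ∀ n i j, Q.d n i j = 0) : Q ≅ H.obj Q :=
  isoOfBijective
    { f := fun n i => toHomology n i ∘ₗ
        LinearMap.codRestrict (Q.cycles n i) LinearMap.id (mem_cycles_of_d_eq_zero hQ)
      f_d := fun n i j x => by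
        rw [hQ, LinearMap.zero_apply, map_zero]
        rfl
      f_act := fun _ _ _ _ => rfl
      f_circ := fun _ _ _ _ _ _ _ _ => rfl }
    (fun n i => by
      constructor
      · rw [injective_iff_map_eq_zero]
        intro x hx
        obtain ⟨y, hy⟩ := toHomology_eq_zero.1 hx
        rw [hQ, LinearMap.zero_apply] at hy
        exact hy.symm
      · intro x
        obtain ⟨x, rfl⟩ := toHomology_surjective n i x
        exact ⟨x.1, rfl⟩)

lemma isoHomology_naturality (hQ : ∀ n i j, Q.d n i j = 0) (F : Q ⟶ Q) :
    F ≫ (isoHomology hQ).hom = (isoHomology hQ).hom ≫ H.map F := by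
  ext n i x
  rfl

/-- By naturality of `isoHomology`, the conjugate of `ψ` by this isomorphism is a lift. -/
lemma mapAut_surjective (hQ : ∀ n i j, Q.d n i j = 0) : Function.Surjective (H.mapAut Q) := by
  intro ψ
  let e := isoHomology hQ
  refine ⟨e ≪≫ ψ ≪≫ e.symm, ?_⟩
  ext1
  change H.map (e.hom ≫ ψ.hom ≫ e.inv) = ψ.hom
  rw [← cancel_epi e.hom, ← isoHomology_naturality hQ]
  simp

end ZeroDifferential

lemma exists_surjective_autH {P : DGOperad k} (hP : P.IsFormal) :
    ∃ (P' : DGOperad k) (z : P.Zigzag P'), Function.Surjective z.autH := by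
  obtain ⟨z⟩ := hP
  refine ⟨_, z, ?_⟩
  exact (Aut.autMulEquivOfIso z.homologyIso.symm).surjective.comp
    (mapAut_surjective (Q := H.obj P) fun _ _ _ => rfl)

lemma isFormal_of_zigzag {P P' : DGOperad k} (z : P.Zigzag P') (hP' : P'.IsFormal) :
    P.IsFormal := by
  have trans : ∀ {R : DGOperad k}, P'.Zigzag R → Nonempty (P.Zigzag R) := by
    intro R z'
    induction z' with
    | refl => exact ⟨z⟩
    | fwd _ F hF ih => exact ⟨ih.some.fwd F hF⟩
    | bwd _ F hF ih => exact ⟨ih.some.bwd F hF⟩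
  obtain ⟨z'⟩ := hP'
  -- The chains lead from `P` to `HP'`; the induced isomorphism between `HP` and `HP'` is the last
  -- link.
  exact ⟨(trans z').some.bwd z.homologyIso.hom (isWeakEquiv_of_iso _)⟩

/-- Multiplication by a scalar in each degree commutes with the linear identification of `HP` with
`HP'`. -/
lemma homologyMap_of_autH {P P' : DGOperad k} (z : P.Zigzag P') (f : Aut P') (α : kˣ)
    (hf : z.autH f = P.homologyGradingAut α) (n : ℕ) (i : ℤ) (x : P'.Homology n i) :
    homologyMap f.hom n i x = ((α ^ i : kˣ) : k) • x := by
  have h : z.homologyIso.hom ≫ H.map f.hom ≫ z.homologyIso.inv =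
      (P.homologyGradingAut α).hom := by
    rw [← hf]
    rfl
  have h' : H.map f.hom =
      z.homologyIso.inv ≫ (P.homologyGradingAut α).hom ≫ z.homologyIso.hom := by
    rw [← h]
    simp
  have h'' := congrArg (fun F : H.obj P' ⟶ H.obj P' => F.f n i x) h'
  refine h''.trans ?_
  change z.homologyIso.hom.f n i (((α ^ i : kˣ) : k) • z.homologyIso.inv.f n i x) = _
  rw [map_smul]
  exact congrArg _ (inv_hom_f _ _ _ _)

lemma finite_homology {P P' : DGOperad k} (z : P.Zigzag P') (hP : P.HomologyFiniteType)
    (n : ℕ) (i : ℤ) : Module.Finite k (P'.Homology n i) := by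
  have := hP n
  have h₁ : Module.Finite k ((H.obj P).X n i) :=
    Module.Finite.of_surjective (DirectSum.component k ℤ (fun i => P.Homology n i) i)
      fun x => ⟨DirectSum.lof k ℤ (fun i => P.Homology n i) i x,
        DirectSum.component.lof_self k (M := fun i => P.Homology n i) i x⟩
  exact Module.Finite.of_surjective (M := (H.obj P).X n i) (z.homologyIso.hom.f n i)
    fun x => ⟨z.homologyIso.inv.f n i x, inv_hom_f _ _ _ _⟩

end DGOperad

/-! ### Purity of the grading automorphisms -/

namespace WeightFunction

variable {k : Type u} [Field k]

/-- The weight function on the powers of an element of infinite order, for which it has weight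
one. -/
noncomputable def ofInfiniteOrder (α : kˣ) (hα : ¬ IsOfFinOrder α) : WeightFunction k :=
  let β : (AlgebraicClosure k)ˣ := Units.map (algebraMap k (AlgebraicClosure k)).toMonoidHom α
  have hβ : Function.Injective (zpowersHom (AlgebraicClosure k)ˣ β) := by
    have : ¬ IsOfFinOrder β := fun h => hα
      ((Units.map_injective (algebraMap k (AlgebraicClosure k)).injective).isOfFinOrder_iff.1 h)
    intro m n h
    exact Multiplicative.toAdd.injective (injective_zpow_iff_not_isOfFinOrder.2 this h)
  { Γ := (zpowersHom (AlgebraicClosure k)ˣ β).range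
    w := (MonoidHom.ofInjective hβ).symm.toMonoidHom }

lemma isPureElement_ofInfiniteOrder (α : kˣ) (hα : ¬ IsOfFinOrder α) (i : ℤ) :
    (ofInfiniteOrder α hα).IsPureElement i
      (algebraMap k (AlgebraicClosure k) ((α ^ i : kˣ) : k)) := by
  refine ⟨⟨_, ⟨Multiplicative.ofAdd i, rfl⟩⟩, ?_, ?_⟩
  · simp
  · refine congrArg (a₂ := Multiplicative.ofAdd i) Multiplicative.toAdd
      ((MonoidHom.ofInjective _).symm_apply_eq.2 ?_)
    rfl

/-- The scalar `c` is the only possible eigenvalue after extension to the algebraic closure. -/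
lemma isPurePolynomial_charpoly_of_smul (w : WeightFunction k) {i : ℤ} {V : Type u}
    [AddCommGroup V] [Module k V] [Module.Finite k V] (φ : V →ₗ[k] V) (c : k)
    (hφ : ∀ v, φ v = c • v) (hc : w.IsPureElement i (algebraMap k (AlgebraicClosure k) c)) :
    w.IsPurePolynomial i φ.charpoly := by
  intro x hx
  let K := AlgebraicClosure k
  have hx' : (φ.baseChange K).charpoly.IsRoot x := by
    rw [LinearMap.charpoly_baseChange]
    exact isRoot_of_mem_roots hx
  rw [← Module.End.hasEigenvalue_iff_isRoot_charpoly] at hx'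
  obtain ⟨v, hv⟩ := hx'.exists_hasEigenvector
  have h : φ.baseChange K v = algebraMap k K c • v := by
    have : φ = c • LinearMap.id := LinearMap.ext hφ
    rw [this, LinearMap.baseChange_smul, LinearMap.baseChange_id, algebraMap_smul]
    rfl
  have e : x = algebraMap k K c := by
    have := hv.apply_eq_smul.symm.trans h
    rw [← sub_eq_zero, ← sub_smul] at this
    exact sub_eq_zero.1 ((smul_eq_zero.1 this).resolve_right hv.2)
  rw [e]
  exact hc

end WeightFunction

/-! ### The equivalence of the four statements -/

theorem mainTheorem6 {k : Type u} [Field k] [CharZero k] (P : DGOperad k)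
    (hP1 : ∀ i, Subsingleton (P.Homology 1 i)) (hP : P.HomologyFiniteType) :
    List.TFAE [
      P.IsFormal,
      ∃ (P' : DGOperad k) (z : P.Zigzag P'), Function.Surjective z.autH,
      ∃ (P' : DGOperad k) (z : P.Zigzag P') (f : Aut P') (α : kˣ),
        ¬ IsOfFinOrder α ∧ z.autH f = P.homologyGradingAut α,
      ∃ (P' : DGOperad k) (_ : P.Zigzag P') (f : P' ⟶ P') (w : WeightFunction k),
        w.IsPureEndo 0 f] := by
  tfae_have 1 → 2 := DGOperad.exists_surjective_autH
  tfae_have 2 → 3 := by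
    rintro ⟨P', z, hz⟩
    -- In characteristic zero `2` is invertible and is not a root of unity.
    let α : kˣ := Units.mk0 2 two_ne_zero
    obtain ⟨f, hf⟩ := hz (P.homologyGradingAut α)
    refine ⟨P', z, f, α, fun h => ?_, hf⟩
    obtain ⟨n, hn, h⟩ := isOfFinOrder_iff_pow_eq_one.1 h
    have h2 : (2 : k) ^ n = 1 := by simpa [α] using congrArg Units.val h
    have h3 : 2 ^ n = 1 := by exact_mod_cast h2
    exact absurd h3 (Nat.one_lt_two_pow hn.ne').ne'
  tfae_have 3 → 4 := by
    rintro ⟨P', z, f, α, hα, hf⟩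
    refine ⟨P', z, f.hom, WeightFunction.ofInfiniteOrder α hα, fun n i => ?_⟩
    have := DGOperad.finite_homology z hP n i
    refine ⟨this, ?_⟩
    rw [zero_add]
    exact WeightFunction.isPurePolynomial_charpoly_of_smul _ _ _
      (DGOperad.homologyMap_of_autH z f α hf n i)
      (WeightFunction.isPureElement_ofInfiniteOrder α hα i)
  tfae_have 4 → 1 := by
    rintro ⟨P', z, f, w, hf⟩
    exact DGOperad.isFormal_of_zigzag z (w.isFormal_of_isPureEndo f hf)
  tfae_finish
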